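/- For real parameters $\alpha,\beta,\gamma$ with $\gamma>0$, let $F(\alpha,\beta;\gamma;\omega)$ denote the Gaussian hypergeometric function, i.e. the analytic continuation to $\mathbb{C}\setminus[1,\infty)$ of the power series $$\sum_{n=0}^{\infty}\frac{(\alpha)_n(\beta)_n}{(\gamma)_n\,n!}\,\omega^n,\qquad |\omega|<1,\qquad (\alpha)_n=\alpha(\alpha+1)\cdots(\alpha+n-1).$$ A domain in $\mathbb{C}$ is called convex in the direction of the imaginary axis if every line parallel to the imaginary axis has a connected or empty intersection with it. **Theorem.** Let $a,b,c\in\mathbb{R}$ with $-1<a\le c$ and $0\le b\le c$. Then the hypergeometric functions below are analytic in $\mathbb{C}\setminus[1,\infty)$, the denominators have no zeros there, and the six functions $$\omega\mapsto\frac{F(a+1,b+1;c+1;\omega)}{F(a+1,b;c+1;\omega)},\qquad \omega\mapsto\frac{\omega F(a+1,b+1;c+1;\omega)}{F(a+1,b;c+1;\omega)},$$ $$\omega\mapsto\frac{F(a+2,b+1;c+2;\omega)}{F(a+1,b;c+1;\omega)},\qquad \omega\mapsto\frac{\omega F(a+2,b+1;c+2;\omega)}{F(a+1,b;c+1;\omega)},$$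 $$\omega\mapsto\frac{F(a+2,b+1;c+2;\omega)}{F(a+1,b+1;c+1;\omega)},\qquad \omega\mapsto\frac{\omega F(a+2,b+1;c+2;\omega)}{F(a+1,b+1;c+1;\omega)}$$ are analytic in $\mathbb{C}\setminus[1,\infty)$. Moreover, each of these functions, where for the fifth one, $F(a+2,b+1;c+2;\omega)/F(a+1,b+1;c+1;\omega)$, it is assumed in addition that $a<c$, maps both the open unit disk $\{|\omega|<1\}$ and the half-plane $\{\omega\in\mathbb{C}:\operatorname{Re}\omega<1\}$ univalently onto domains that are convex in the direction of the imaginary axis. -/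

import Mathlib

/-- The slit plane `ℂ ∖ [1, ∞)`. -/
def cutPlane : Set ℂ := (Complex.ofReal '' Set.Ici (1 : ℝ))ᶜ

/-- The half-plane `Re ω < 1`. -/
def halfPlaneReLtOne : Set ℂ := {ω : ℂ | ω.re < 1}

/-- `f` is an analytic continuation to `ℂ ∖ [1, ∞)` of the Gaussian hypergeometric series
`∑ (a)ₙ (b)ₙ / ((c)ₙ n!) ωⁿ`, `|ω| < 1`. -/
structure IsHypergeometricContinuation (a b c : ℂ) (f : ℂ → ℂ) : Prop where
  analytic : AnalyticOnNhd ℂ f cutPlane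
  eq_series : ∀ ω ∈ Metric.ball (0 : ℂ) 1, f ω = ordinaryHypergeometric a b c ω

open Classical in
/-- The Gaussian hypergeometric function `F(a, b; c; ·)` on `ℂ ∖ [1, ∞)`: the analytic
continuation of the hypergeometric series from the unit disk. (If there were no such continuation,
the value is that of the series; the values on `[1, ∞)` have no meaning.) -/
noncomputable def gaussF (a b c : ℂ) : ℂ → ℂ :=
  if h : ∃ f : ℂ → ℂ, IsHypergeometricContinuation a b c f then h.choose
  else ordinaryHypergeometric a b c

/-- A domain (non-empty connected open set) that is convex in the direction of the imaginary axis: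
each line parallel to the imaginary axis meets it in a connected or empty set. -/
structure IsDomainConvexInImagDirection (D : Set ℂ) : Prop where
  isOpen : IsOpen D
  isConnected : IsConnected D
  vertical : ∀ x : ℝ, IsPreconnected (D ∩ {w : ℂ | w.re = x})

/-- `f` maps `S` univalently (analytically and injectively) onto a domain that is convex in the
direction of the imaginary axis. -/
structure MapsUnivalentlyOntoConvexImag (f : ℂ → ℂ) (S : Set ℂ) : Prop where
  analytic : AnalyticOnNhd ℂ f S
  injOn : Set.InjOn f S
  image : IsDomainConvexInImagDirection (f '' S)

/-- `f` has the mapping property above both on the open unit disk and on `Re ω < 1`. -/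
def HasMappingProperty (f : ℂ → ℂ) : Prop :=
  MapsUnivalentlyOntoConvexImag f (Metric.ball 0 1) ∧
    MapsUnivalentlyOntoConvexImag f halfPlaneReLtOne

/-! Each of the three quotients without the factor `ω` is a Stieltjes transform `∫ dμ(t) / (1 - tω)`
of a finite measure on `[0, 1]`, and the mapping properties hold for all such transforms apart from
constants.

The measures come from Gauss' continued fraction. Its coefficients have the form `(1 - g k) * g (k +
1)` with `g k ∈ [0, 1]` (`gaussParam_mem`, `gaussChain_succ`). Such a chain sequence makes a
bidiagonal operator `T` on `ℓ²` a contraction, and the power series quotient has coefficients `⟪e₀,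
(T†T)ⁿ e₀⟫`. By the spectral theorem these are moments of a probability measure on `[0, 1]`
(`exists_measure_of_chainSequence`). The full chain gives the first quotient, its tail the fifth.
For the third, a contiguous relation exhibits `F(a+2,b+1;c+2)/F(a+1,b;c+1)` as the transform of a
multiple of `t dμ(t)`. Up to the factor `b(a+1)/(c+1)` it is also the logarithmic derivative of
`F(a+1,b;c+1)`, so this function is the exponential of an explicit integral; that gives both its
continuation and the absence of zeros (`exists_representation`).

For the geometry, `1/(1-tz) = 1 + t·z/(1-tz)` reduces everything to `f(z) = ∫ z/(1-tz) dν(t)` plus a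
real constant. Injectivity on `Re z < 1` follows from `f(z) - f(w) = (z-w) ∫ dν/((1-tz)(1-tw))`,
where the arguments of the integrand stay in a fixed open half-plane. Vertical convexity follows
from `Im((z-x) f'(z)) > 0` in the upper half of any disk centred at a real `x` with `1` on its
boundary: moving down in the image moves the preimage towards `x`, so it stays in the disk. The unit
disk is one such disk and the half-plane is a union of them. -/

open MeasureTheory ComplexConjugate

/-! ### Chain sequences, contractions on `ℓ²` and Hausdorff moments -/

/-- A positive contraction `A` and a unit vector `e` have a spectral measure on `[0, 1]`. -/
theorem exists_spectralMeasure_unitInterval {H : Type*} [NormedAddCommGroup H]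
    [InnerProductSpace ℂ H] [CompleteSpace H] (A : H →L[ℂ] H) (hA0 : 0 ≤ A) (hA1 : A ≤ 1)
    (e : H) (he : ‖e‖ = 1) :
    ∃ μ : Measure unitInterval, IsProbabilityMeasure μ ∧
      ∀ n : ℕ, ∫ t : unitInterval, (t : ℝ) ^ n ∂μ = (inner ℂ e ((A ^ n) e)).re := by
  have hsa : IsSelfAdjoint A := .of_nonneg hA0
  have hspec : spectrum ℝ A ⊆ unitInterval := by
    intro x hx
    refine ⟨spectrum_nonneg_of_nonneg hA0 hx, ?_⟩
    have h := (le_algebraMap_iff_spectrum_le (r := (1 : ℝ)) (a := A) hsa).1 (by simpa using hA1)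
    exact h x hx
  -- The continuous functional calculus, read on all of `[0, 1]`. It is positive since a nonnegative
  -- function is a square, so `f ↦ ⟪e, Φ f e⟫` is a positive functional to which Riesz–Markov
  -- applies.
  let Φ := cfcHomSuperset hsa hspec
  have hΦ_nonneg : ∀ f : C(unitInterval, ℝ), 0 ≤ f → 0 ≤ Φ f := by
    intro f hf
    obtain ⟨g, hg⟩ : ∃ g : C(unitInterval, ℝ), f = star g * g := by
      refine ⟨⟨fun x => √(f x), by fun_prop⟩, ?_⟩
      ext x
      exact (Real.mul_self_sqrt (hf x)).symm
    rw [hg, map_mul, map_star]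
    exact star_mul_self_nonneg _
  let Λ : CompactlySupportedContinuousMap unitInterval ℝ →ₚ[ℝ] ℝ :=
    PositiveLinearMap.mk₀
      { toFun := fun f => (inner ℂ e (Φ f.toContinuousMap e)).re
        map_add' := fun f g => by
          change (inner ℂ e (Φ (f.toContinuousMap + g.toContinuousMap) e)).re = _
          simp
        map_smul' := fun r f => by
          change (inner ℂ e (Φ (r • f.toContinuousMap) e)).re = _
          simp [map_smul] }
      (fun f hf => by
        have h := hΦ_nonneg f.toContinuousMap hf
        exact ((ContinuousLinearMap.nonneg_iff_isPositive _).1 h).re_inner_nonneg_right e)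
  have hΛ : ∀ f : C(unitInterval, ℝ),
      ∫ t, f t ∂(RealRMK.rieszMeasure Λ) = (inner ℂ e (Φ f e)).re := fun f =>
    RealRMK.integral_rieszMeasure Λ (CompactlySupportedContinuousMap.continuousMapEquiv f)
  have hmoment : ∀ n : ℕ, ∫ t : unitInterval, (t : ℝ) ^ n ∂(RealRMK.rieszMeasure Λ) =
      (inner ℂ e ((A ^ n) e)).re := by
    intro n
    have h := hΛ ((ContinuousMap.restrict unitInterval (.id ℝ)) ^ n)
    rw [map_pow, cfcHomSuperset_id hsa hspec] at h
    simpa using h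
  refine ⟨RealRMK.rieszMeasure Λ, ⟨?_⟩, hmoment⟩
  have h0 := hmoment 0
  simp only [pow_zero, integral_const, smul_eq_mul, mul_one, one_apply_eq_self,
    inner_self_eq_norm_sq_to_K, he] at h0
  have h1 : (RealRMK.rieszMeasure Λ).real Set.univ = 1 := by simpa using h0
  exact (ENNReal.toReal_eq_one_iff _).1 h1

/-- A bidiagonal operator on `ℓ²` whose entries come from a chain sequence is a contraction. -/
theorem exists_bidiagonal_contraction (x y s : ℕ → ℝ) (hx : ∀ k, 0 ≤ x k) (hy : ∀ k, 0 ≤ y k)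
    (hs : ∀ k, s k ∈ unitInterval)
    (h : ∀ k, ∀ α β : ℝ, (x k * α + y k * β) ^ 2 ≤ (1 - s k) * α ^ 2 + s (k + 1) * β ^ 2) :
    ∃ T : lp (fun _ : ℕ => ℂ) 2 →L[ℂ] lp (fun _ : ℕ => ℂ) 2, ‖T‖ ≤ 1 ∧
      ∀ v k, T v k = x k * v k + y k * v (k + 1) := by
  have hp : 0 < (2 : ENNReal).toReal := by norm_num
  -- Summing `h` telescopes: the term `s (k + 1) * β ^ 2` gained at `k` is what is given up at `k +
  -- 1`. The remaining boundary term is at most `‖v n‖ ^ 2`, so it fits into one more summand of the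
  -- norm.
  have hpartial : ∀ (v : lp (fun _ : ℕ => ℂ) 2) (n : ℕ),
      ∑ k ∈ Finset.range n, ‖(x k * v k + y k * v (k + 1) : ℂ)‖ ^ 2 ≤
        ∑ k ∈ Finset.range n, ‖v k‖ ^ 2 + s n * ‖v n‖ ^ 2 := by
    intro v n
    induction n with
    | zero => simpa using mul_nonneg (hs 0).1 (sq_nonneg _)
    | succ n ih =>
      rw [Finset.sum_range_succ, Finset.sum_range_succ]
      have h1 : ‖(x n * v n + y n * v (n + 1) : ℂ)‖ ≤ x n * ‖v n‖ + y n * ‖v (n + 1)‖ := by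
        refine (norm_add_le _ _).trans_eq ?_
        simp [abs_of_nonneg, hx n, hy n]
      have h2 := pow_le_pow_left₀ (norm_nonneg _) h1 2
      have h3 := h n ‖v n‖ ‖v (n + 1)‖
      linarith
  have hnorm : ∀ (v : lp (fun _ : ℕ => ℂ) 2) (S : Finset ℕ),
      ∑ k ∈ S, ‖(x k * v k + y k * v (k + 1) : ℂ)‖ ^ (2 : ENNReal).toReal ≤
        ‖v‖ ^ (2 : ENNReal).toReal := by
    intro v S
    obtain ⟨n, hn⟩ := S.exists_nat_subset_range
    refine (Finset.sum_le_sum_of_subset_of_nonneg hn fun _ _ _ => by positivity).trans ?_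
    have h1 := lp.sum_rpow_le_norm_rpow hp v (Finset.range (n + 1))
    simp only [ENNReal.toReal_ofNat, Real.rpow_two] at h1 ⊢
    refine le_trans ?_ h1
    rw [Finset.sum_range_succ]
    have := mul_le_of_le_one_left (sq_nonneg ‖v n‖) (hs n).2
    linarith [hpartial v n]
  let T₀ : lp (fun _ : ℕ => ℂ) 2 →ₗ[ℂ] lp (fun _ : ℕ => ℂ) 2 :=
    { toFun := fun v => ⟨fun k => x k * v k + y k * v (k + 1), memℓp_gen' (hnorm v)⟩
      map_add' := fun v w => by
        ext k
        simp only [lp.coeFn_add, Pi.add_apply]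
        ring
      map_smul' := fun c v => by
        ext k
        simp only [lp.coeFn_smul, Pi.smul_apply, smul_eq_mul, RingHom.id_apply]
        ring }
  refine ⟨T₀.mkContinuous 1 fun v => ?_, LinearMap.mkContinuous_norm_le _ zero_le_one _,
    fun v k => rfl⟩
  rw [one_mul]
  exact lp.norm_le_of_forall_sum_le hp (norm_nonneg _) (hnorm v)

/-- The generating series of the quotient of two consecutive solutions of the recursion of a
continued fraction with chain sequence coefficients is a Hausdorff moment sequence. -/
theorem exists_measure_of_chainSequence (g : ℕ → ℝ) (hg : ∀ k, g k ∈ unitInterval)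
    (h : ℕ → PowerSeries ℝ) (h0 : PowerSeries.constantCoeff (h 0) = 1)
    (hrec : ∀ k, h (k + 1) =
      h k + PowerSeries.C ((1 - g k) * g (k + 1)) * PowerSeries.X * h (k + 2)) :
    ∃ μ : Measure unitInterval, IsProbabilityMeasure μ ∧
      h 1 = h 0 * PowerSeries.mk fun n => ∫ t : unitInterval, (t : ℝ) ^ n ∂μ := by
  set a : ℕ → ℝ := fun k => (1 - g k) * g (k + 1) with ha_def
  have ha : ∀ k, 0 ≤ a k := fun k => mul_nonneg (sub_nonneg.2 (hg k).2) (hg (k + 1)).1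
  set x : ℕ → ℝ := fun k => √(a (2 * k)) with hx_def
  set y : ℕ → ℝ := fun k => √(a (2 * k + 1)) with hy_def
  have hxx : ∀ k, x k * x k = a (2 * k) := fun k => Real.mul_self_sqrt (ha _)
  have hyy : ∀ k, y k * y k = a (2 * k + 1) := fun k => Real.mul_self_sqrt (ha _)
  obtain ⟨T, hT, hTv⟩ := exists_bidiagonal_contraction x y (fun k => g (2 * k))
    (fun k => Real.sqrt_nonneg _) (fun k => Real.sqrt_nonneg _) (fun k => hg _) (by
      intro k α β
      have hm := hg (2 * k + 1)
      have h1 : x k = √(1 - g (2 * k)) * √(g (2 * k + 1)) :=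
        Real.sqrt_mul (sub_nonneg.2 (hg _).2) _
      have h2 : y k = √(1 - g (2 * k + 1)) * √(g (2 * (k + 1))) :=
        Real.sqrt_mul (sub_nonneg.2 (hg _).2) _
      have e1 := Real.sq_sqrt (sub_nonneg.2 (hg (2 * k)).2)
      have e2 := Real.sq_sqrt hm.1
      have e3 := Real.sq_sqrt (sub_nonneg.2 hm.2)
      have e4 := Real.sq_sqrt (hg (2 * (k + 1))).1
      rw [h1, h2]
      generalize √(1 - g (2 * k)) = p at *
      generalize √(g (2 * k + 1)) = q at *
      generalize √(1 - g (2 * k + 1)) = r at *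
      generalize √(g (2 * (k + 1))) = t at *
      change _ ≤ (1 - g (2 * k)) * α ^ 2 + g (2 * (k + 1)) * β ^ 2
      rw [← e1, ← e4]
      have e5 : q ^ 2 + r ^ 2 = 1 := by linarith
      -- Cauchy–Schwarz for the unit vector `(q, r)` and `(p * α, t * β)`, in the form of Lagrange's
      -- identity.
      have : p ^ 2 * α ^ 2 + t ^ 2 * β ^ 2 - (p * q * α + r * t * β) ^ 2 =
          (r * (p * α) - q * (t * β)) ^ 2 +
            (1 - (q ^ 2 + r ^ 2)) * ((p * α) ^ 2 + (t * β) ^ 2) := by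
        ring
      rw [e5] at this
      nlinarith [sq_nonneg (r * (p * α) - q * (t * β))])
  have hT0 : T (lp.single 2 0 1) = lp.single 2 0 (x 0 : ℂ) := by
    ext k
    rw [hTv]
    rcases k with _ | k <;> simp
  have hTk : ∀ k, T (lp.single 2 (k + 1) 1) =
      lp.single 2 (k + 1) (x (k + 1) : ℂ) + lp.single 2 k (y k : ℂ) := by
    intro k
    ext j
    rw [hTv]
    simp only [lp.coeFn_single, lp.coeFn_add, Pi.add_apply, Pi.single_apply, add_left_inj]
    split_ifs <;> simp_all
  have hadj0 : ∀ w, T.adjoint w 0 = x 0 * w 0 := by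
    intro w
    have h1 := T.adjoint_inner_right (lp.single 2 0 1) w
    rw [hT0, lp.inner_single_left, lp.inner_single_left] at h1
    simpa [mul_comm] using h1
  have hadjk : ∀ w k, T.adjoint w (k + 1) = x (k + 1) * w (k + 1) + y k * w k := by
    intro w k
    have h1 := T.adjoint_inner_right (lp.single 2 (k + 1) 1) w
    rw [hTk, inner_add_left, lp.inner_single_left, lp.inner_single_left,
      lp.inner_single_left] at h1
    simpa [mul_comm] using h1
  set c : ℕ → ℝ := fun k => ∏ j ∈ Finset.range k, x j * y j with hc_def
  have hc : ∀ k, c (k + 1) = c k * (x k * y k) := fun k => Finset.prod_range_succ _ _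
  have hu : h 0 * (h 0)⁻¹ = 1 := PowerSeries.mul_inv_cancel _ (by rw [h0]; exact one_ne_zero)
  generalize (h 0)⁻¹ = u at hu
  -- `V` is the formal resolvent vector `(1 - X T†T)⁻¹ e₀` and `W = T V`. The recursion at odd
  -- indices gives `W = T V`, and at even indices `V = e₀ + X T† W`; the factor `c k` symmetrizes
  -- the recursion.
  let V : ℕ → PowerSeries ℝ := fun k => PowerSeries.C (c k) * PowerSeries.X ^ k * h (2 * k + 1) * u
  let W : ℕ → PowerSeries ℝ := fun k => PowerSeries.C (x k) * V k + PowerSeries.C (y k) * V (k + 1)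
  have hW : ∀ k, W k = PowerSeries.C (x k * c k) * PowerSeries.X ^ k * h (2 * k + 2) * u := by
    intro k
    have h1 := hrec (2 * k + 1)
    change h (2 * k + 2) = h (2 * k + 1) +
      PowerSeries.C (a (2 * k + 1)) * PowerSeries.X * h (2 * k + 3) at h1
    simp only [W, V]
    rw [hc, h1, ← hyy, show 2 * (k + 1) + 1 = 2 * k + 3 by ring]
    simp only [map_mul]
    ring
  have hV0 : V 0 = 1 + PowerSeries.X * (PowerSeries.C (x 0) * W 0) := by
    have h1 := hrec 0
    change h 1 = h 0 + PowerSeries.C (a 0) * PowerSeries.X * h 2 at h1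
    rw [hW]
    simp only [V, hc_def, Finset.range_zero, Finset.prod_empty, map_one, mul_zero, zero_add,
      pow_zero, mul_one, one_mul]
    rw [h1, add_mul, hu, show a 0 = x 0 * x 0 from (hxx 0).symm, map_mul]
    ring
  have hVk : ∀ k, V (k + 1) =
      PowerSeries.X * (PowerSeries.C (x (k + 1)) * W (k + 1) + PowerSeries.C (y k) * W k) := by
    intro k
    have h1 := hrec (2 * k + 2)
    change h (2 * k + 3) = h (2 * k + 2) +
      PowerSeries.C (a (2 * (k + 1))) * PowerSeries.X * h (2 * k + 4) at h1
    rw [hW, hW]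
    simp only [V]
    rw [show 2 * (k + 1) + 1 = 2 * k + 3 by ring, h1, ← hxx, hc,
      show 2 * (k + 1) + 2 = 2 * k + 4 by ring]
    simp only [map_mul]
    ring
  set A := T.adjoint ∘L T with hA_def
  have hA0 : 0 ≤ A :=
    (ContinuousLinearMap.nonneg_iff_isPositive _).2 T.isPositive_adjoint_comp_self
  have hA1 : A ≤ 1 := by
    refine (CStarAlgebra.norm_le_one_iff_of_nonneg A hA0).1 ?_
    rw [hA_def, ContinuousLinearMap.norm_adjoint_comp_self]
    exact mul_le_one₀ hT (norm_nonneg _) hT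
  -- Comparing coefficients in `V = e₀ + X A V`.
  have hcoord : ∀ n k, (A ^ n) (lp.single 2 0 1) k = ((PowerSeries.coeff n (V k) : ℝ) : ℂ) := by
    intro n
    induction n with
    | zero =>
      intro k
      rcases k with _ | k
      · simp [hV0]
      · simp [hVk]
    | succ n ih =>
      have hTW : ∀ k, T ((A ^ n) (lp.single 2 0 1)) k =
          ((PowerSeries.coeff n (W k) : ℝ) : ℂ) := by
        intro k
        rw [hTv, ih, ih]
        simp [W]
      intro k
      rw [pow_succ']
      change T.adjoint (T ((A ^ n) (lp.single 2 0 1))) k = _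
      rcases k with _ | k
      · rw [hadj0, hTW, hV0]
        simp [PowerSeries.coeff_succ_X_mul, PowerSeries.coeff_one]
      · rw [hadjk, hTW, hTW, hVk]
        simp [PowerSeries.coeff_succ_X_mul]
  obtain ⟨μ, hμ, hmom⟩ := exists_spectralMeasure_unitInterval A hA0 hA1 (lp.single 2 0 1)
    (by simp [lp.norm_single])
  refine ⟨μ, hμ, ?_⟩
  have hV : V 0 = PowerSeries.mk fun n => ∫ t : unitInterval, (t : ℝ) ^ n ∂μ := by
    ext n
    rw [PowerSeries.coeff_mk, hmom, lp.inner_single_left, hcoord]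
    simp
  have hV' : V 0 = h 1 * u := by simp [V, hc_def]
  rw [← hV, hV', mul_left_comm, hu, mul_one]

/-! ### The slit plane and integrals over `[0, 1]` -/

theorem isOpen_cutPlane : IsOpen cutPlane :=
  (Complex.isometry_ofReal.isClosedEmbedding.isClosedMap _ isClosed_Ici).isOpen_compl

theorem mem_cutPlane_of_im_ne_zero {z : ℂ} (hz : z.im ≠ 0) : z ∈ cutPlane := by
  rintro ⟨r, -, rfl⟩
  exact hz (Complex.ofReal_im r)

theorem mem_cutPlane_of_re_lt_one {z : ℂ} (hz : z.re < 1) : z ∈ cutPlane := by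
  rintro ⟨r, hr, rfl⟩
  exact not_lt.2 hr hz

theorem starConvex_cutPlane : StarConvex ℝ 0 cutPlane := by
  rw [starConvex_zero_iff]
  intro z hz s hs0 hs1 hsz
  obtain ⟨r, hr, hrz⟩ := hsz
  rw [Set.mem_Ici] at hr
  have hs : 0 < s := by
    refine hs0.lt_of_ne ?_
    rintro rfl
    simp only [zero_smul, Complex.ofReal_eq_zero] at hrz
    linarith
  refine hz ⟨r / s, (hr.trans (le_div_self (by linarith) hs hs1)), ?_⟩
  rw [Complex.ofReal_div, hrz, Complex.real_smul, mul_div_cancel_left₀]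
  exact_mod_cast hs.ne'

theorem isPreconnected_cutPlane : IsPreconnected cutPlane :=
  (starConvex_cutPlane.isPathConnected
    (mem_cutPlane_of_re_lt_one (by simp))).isConnected.isPreconnected

theorem ball_subset_cutPlane : Metric.ball (0 : ℂ) 1 ⊆ cutPlane := by
  intro z hz
  refine mem_cutPlane_of_re_lt_one ((Complex.re_le_norm z).trans_lt ?_)
  simpa using hz

theorem halfPlaneReLtOne_subset_cutPlane : halfPlaneReLtOne ⊆ cutPlane :=
  fun _ hz => mem_cutPlane_of_re_lt_one hz

theorem one_sub_mul_mem_slitPlane {z : ℂ} (hz : z ∈ cutPlane) (t : unitInterval) :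
    1 - (t : ℂ) * z ∈ Complex.slitPlane := by
  rw [Complex.mem_slitPlane_iff]
  by_contra! h
  obtain ⟨h1, h2⟩ := h
  simp only [Complex.sub_re, Complex.one_re, Complex.re_ofReal_mul, Complex.sub_im, Complex.one_im,
    Complex.im_ofReal_mul, zero_sub, neg_eq_zero, mul_eq_zero] at h1 h2
  have ht0 := t.2.1
  have ht1 := t.2.2
  rcases h2 with h2 | h2
  · rw [h2] at h1
    linarith
  · refine hz ⟨z.re, ?_, Complex.ext rfl (by simp [h2])⟩
    rw [Set.mem_Ici]
    have ht : 0 < (t : ℝ) := ht0.lt_of_ne fun h => by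
      rw [← h] at h1
      linarith
    by_contra! hre
    linarith [mul_lt_mul_of_pos_left hre ht]

theorem one_sub_mul_ne_zero {z : ℂ} (hz : z ∈ cutPlane) (t : unitInterval) :
    1 - (t : ℂ) * z ≠ 0 :=
  Complex.slitPlane_ne_zero (one_sub_mul_mem_slitPlane hz t)

theorem integrable_of_continuous_unitInterval {E : Type*} [NormedAddCommGroup E]
    {ν : Measure unitInterval} [IsFiniteMeasure ν] {φ : unitInterval → E} (hφ : Continuous φ) :
    Integrable φ ν :=
  hφ.integrable_of_hasCompactSupport (HasCompactSupport.of_compactSpace φ)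

theorem integral_pos_of_continuous_unitInterval {ν : Measure unitInterval} [IsFiniteMeasure ν]
    (hν : ν ≠ 0) {φ : unitInterval → ℝ} (hφ : Continuous φ) (hpos : ∀ t, 0 < φ t) :
    0 < ∫ t, φ t ∂ν := by
  rw [integral_pos_iff_support_of_nonneg (fun t => (hpos t).le)
    (integrable_of_continuous_unitInterval hφ)]
  have : Function.support φ = Set.univ := Set.eq_univ_of_forall fun t => (hpos t).ne'
  rw [this]
  exact Measure.measure_univ_pos.2 hν

theorem im_integral_unitInterval {ν : Measure unitInterval} [IsFiniteMeasure ν]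
    {φ : unitInterval → ℂ} (hφ : Continuous φ) : (∫ t, φ t ∂ν).im = ∫ t, (φ t).im ∂ν :=
  (integral_im (𝕜 := ℂ) (integrable_of_continuous_unitInterval hφ)).symm

theorem re_integral_unitInterval {ν : Measure unitInterval} [IsFiniteMeasure ν]
    {φ : unitInterval → ℂ} (hφ : Continuous φ) : (∫ t, φ t ∂ν).re = ∫ t, (φ t).re ∂ν :=
  (integral_re (𝕜 := ℂ) (integrable_of_continuous_unitInterval hφ)).symm

theorem hasDerivAt_integral_unitInterval {ν : Measure unitInterval} [IsFiniteMeasure ν]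
    {φ φ' : unitInterval → ℂ → ℂ} {U : Set ℂ} (hU : IsOpen U)
    (hφ : ∀ z ∈ U, Continuous fun t => φ t z)
    (hφ' : ContinuousOn (Function.uncurry φ') (Set.univ ×ˢ U))
    (hd : ∀ t, ∀ z ∈ U, HasDerivAt (φ t) (φ' t z) z) {z : ℂ} (hz : z ∈ U) :
    HasDerivAt (fun w => ∫ t, φ t w ∂ν) (∫ t, φ' t z ∂ν) z := by
  obtain ⟨r, hr, hrU⟩ := Metric.nhds_basis_closedBall.mem_iff.1 (hU.mem_nhds hz)
  obtain ⟨C, hC⟩ := (isCompact_univ.prod (isCompact_closedBall z r)).exists_bound_of_continuousOn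
    (hφ'.mono (Set.prod_mono le_rfl hrU))
  refine (hasDerivAt_integral_of_dominated_loc_of_deriv_le (μ := ν) (bound := fun _ => C)
    (F := fun w t => φ t w) (F' := fun w t => φ' t w)
    (Metric.closedBall_mem_nhds z hr) ?_ ?_ ?_ ?_ (integrable_const C) ?_).2
  · filter_upwards [hU.mem_nhds hz] with w hw using (hφ w hw).aestronglyMeasurable
  · exact integrable_of_continuous_unitInterval (hφ z hz)
  · refine Continuous.aestronglyMeasurable ?_
    have := hφ'.comp_continuous (f := fun t : unitInterval => (t, z)) (by fun_prop)
      fun t => ⟨Set.mem_univ _, hz⟩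
    exact this
  · exact Filter.Eventually.of_forall fun t w hw => hC (t, w) ⟨Set.mem_univ _, hw⟩
  · exact Filter.Eventually.of_forall fun t w hw => hd t w (hrU hw)

/-! ### The kernel transform: half-planes and univalence -/

/-- The Stieltjes-type transform `z ↦ ∫ z / (1 - t z) dν(t)` of a measure on `[0, 1]`. -/
noncomputable def kernelTransform (ν : Measure unitInterval) (z : ℂ) : ℂ :=
  ∫ t : unitInterval, z / (1 - (t : ℂ) * z) ∂ν

theorem kernelTransform_conj {ν : Measure unitInterval} (z : ℂ) :
    kernelTransform ν (conj z) = conj (kernelTransform ν z) := by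
  rw [kernelTransform, kernelTransform, ← integral_conj]
  simp

theorem kernelTransform_im_eq_zero {ν : Measure unitInterval} {z : ℂ} (hz : z.im = 0) :
    (kernelTransform ν z).im = 0 := by
  rw [← Complex.conj_eq_iff_im, ← kernelTransform_conj, Complex.conj_eq_iff_im.2 hz]

theorem one_sub_mul_pos {x : ℝ} (hx : x < 1) (t : unitInterval) : 0 < 1 - t * x := by
  rcases t.2.1.eq_or_lt with h | h
  · simp [← h]
  · linarith [mul_lt_mul_of_pos_left hx h, t.2.2]

section KernelTransform

variable {ν : Measure unitInterval} [IsFiniteMeasure ν]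

theorem continuous_div_one_sub_mul {z : ℂ} (hz : z ∈ cutPlane) (c : ℂ) :
    Continuous fun t : unitInterval => c / (1 - (t : ℂ) * z) := by
  refine Continuous.div (by fun_prop) (by fun_prop) fun t => one_sub_mul_ne_zero hz t

theorem continuous_inv_one_sub_mul_mul {z w : ℂ} (hz : z ∈ cutPlane) (hw : w ∈ cutPlane) :
    Continuous fun t : unitInterval => ((1 - (t : ℂ) * z) * (1 - (t : ℂ) * w))⁻¹ := by
  refine Continuous.inv₀ (by fun_prop) fun t => ?_
  exact mul_ne_zero (one_sub_mul_ne_zero hz t) (one_sub_mul_ne_zero hw t)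

theorem hasDerivAt_kernelTransform {z : ℂ} (hz : z ∈ cutPlane) :
    HasDerivAt (kernelTransform ν)
      (∫ t : unitInterval, ((1 - (t : ℂ) * z) * (1 - (t : ℂ) * z))⁻¹ ∂ν) z := by
  refine hasDerivAt_integral_unitInterval (φ := fun t w => w / (1 - (t : ℂ) * w))
    (φ' := fun t w => ((1 - (t : ℂ) * w) * (1 - (t : ℂ) * w))⁻¹) isOpen_cutPlane
    (fun w hw => continuous_div_one_sub_mul hw w) ?_ ?_ hz
  · refine ContinuousOn.inv₀ (by fun_prop) fun p hp => ?_
    exact mul_self_ne_zero.2 (one_sub_mul_ne_zero hp.2 p.1)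
  · intro t w hw
    have h1 := one_sub_mul_ne_zero hw t
    have h2 : HasDerivAt (fun w : ℂ => 1 - (t : ℂ) * w) (-(t : ℂ)) w := by
      simpa using ((hasDerivAt_id w).const_mul (t : ℂ)).const_sub 1
    refine ((hasDerivAt_id w).div h2 h1).congr_deriv (Eq.symm ?_)
    rw [← sq, inv_eq_one_div]
    congr 1
    simp only [id_eq]
    ring

theorem kernelTransform_sub {z w : ℂ} (hz : z ∈ cutPlane) (hw : w ∈ cutPlane) :
    kernelTransform ν z - kernelTransform ν w =
      (z - w) * ∫ t : unitInterval, ((1 - (t : ℂ) * z) * (1 - (t : ℂ) * w))⁻¹ ∂ν := by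
  rw [kernelTransform, kernelTransform, ← integral_sub
    (integrable_of_continuous_unitInterval (continuous_div_one_sub_mul hz z))
    (integrable_of_continuous_unitInterval (continuous_div_one_sub_mul hw w)),
    ← integral_const_mul]
  refine integral_congr_ae (Filter.Eventually.of_forall fun t => ?_)
  have h1 := one_sub_mul_ne_zero hz t
  have h2 := one_sub_mul_ne_zero hw t
  beta_reduce
  rw [div_sub_div _ _ h1 h2, ← div_eq_mul_inv]
  congr 1
  ring

theorem kernelTransform_im_pos (hν : ν ≠ 0) {z : ℂ} (hz : 0 < z.im) :
    0 < (kernelTransform ν z).im := by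
  have hz' := mem_cutPlane_of_im_ne_zero hz.ne'
  have hc := continuous_div_one_sub_mul hz' z
  rw [kernelTransform, im_integral_unitInterval hc]
  refine integral_pos_of_continuous_unitInterval hν (Complex.continuous_im.comp hc) fun t => ?_
  have h : (z / (1 - (t : ℂ) * z)).im = z.im / Complex.normSq (1 - (t : ℂ) * z) := by
    rw [Complex.div_im]
    simp
    ring
  rw [h]
  exact div_pos hz (Complex.normSq_pos.2 (one_sub_mul_ne_zero hz' t))

theorem kernelTransform_im_neg (hν : ν ≠ 0) {z : ℂ} (hz : z.im < 0) :
    (kernelTransform ν z).im < 0 := by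
  have h := kernelTransform_im_pos hν (z := conj z) (by simpa using hz)
  rw [kernelTransform_conj] at h
  simpa using h

/-- Each factor `(1 - tz)⁻¹`, `(1 - tw)⁻¹` has argument in `[0, π/2)`, and the second stays away
from `π/2` uniformly in `t`. So the products lie in a fixed open half-plane `Im + ε Re > 0`, and so
does their integral. -/
theorem integral_inv_one_sub_mul_mul_ne_zero (hν : ν ≠ 0) {z w : ℂ} (hz : z.re < 1) (hw : w.re < 1)
    (hz0 : 0 ≤ z.im) (hw0 : 0 ≤ w.im) :
    ∫ t : unitInterval, ((1 - (t : ℂ) * z) * (1 - (t : ℂ) * w))⁻¹ ∂ν ≠ 0 := by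
  have hz' := mem_cutPlane_of_re_lt_one hz
  have hw' := mem_cutPlane_of_re_lt_one hw
  have hc := continuous_inv_one_sub_mul_mul hz' hw'
  have hre : Continuous fun t : unitInterval => (((1 - (t : ℂ) * z) * (1 - (t : ℂ) * w))⁻¹).re :=
    Complex.continuous_re.comp hc
  have him : Continuous fun t : unitInterval => (((1 - (t : ℂ) * z) * (1 - (t : ℂ) * w))⁻¹).im :=
    Complex.continuous_im.comp hc
  -- The numerator bounds `1 - t * w.re` from below and the denominator bounds `t * w.im` from
  -- above, for all `t ∈ [0, 1]`.
  set ε : ℝ := min 1 (1 - w.re) / (1 + w.im) with hε_def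
  have hm : 0 < min 1 (1 - w.re) := lt_min one_pos (by linarith)
  have hε : 0 < ε := div_pos hm (by linarith)
  have hεw : ∀ t : unitInterval, ε * (t * w.im) ≤ 1 - t * w.re := by
    intro t
    have ht0 := t.2.1
    have ht1 := t.2.2
    have h1 : ε * (1 + w.im) = min 1 (1 - w.re) := div_mul_cancel₀ _ (by linarith)
    have h2 : (t : ℝ) * w.im ≤ 1 + w.im := by nlinarith
    have h3 : min 1 (1 - w.re) ≤ 1 - t * w.re := by
      rcases le_total 0 w.re with h | h
      · exact (min_le_right _ _).trans (by nlinarith)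
      · exact (min_le_left _ _).trans (by nlinarith)
    calc ε * (t * w.im) ≤ ε * (1 + w.im) := by gcongr
      _ ≤ _ := h1.trans_le h3
  intro h0
  have hpos : 0 < ∫ t : unitInterval, ((((1 - (t : ℂ) * z) * (1 - (t : ℂ) * w))⁻¹).im +
      ε * (((1 - (t : ℂ) * z) * (1 - (t : ℂ) * w))⁻¹).re) ∂ν := by
    refine integral_pos_of_continuous_unitInterval hν (him.add (hre.const_mul ε)) fun t => ?_
    have ht0 := t.2.1
    have hne := mul_ne_zero (one_sub_mul_ne_zero hz' t) (one_sub_mul_ne_zero hw' t)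
    rw [Complex.inv_im, Complex.inv_re, ← mul_div_assoc, ← add_div]
    refine div_pos ?_ (Complex.normSq_pos.2 hne)
    simp only [Complex.mul_im, Complex.mul_re, Complex.sub_re, Complex.sub_im, Complex.one_re,
      Complex.one_im, Complex.ofReal_re, Complex.ofReal_im, zero_mul, sub_zero, add_zero, zero_sub]
    have hzr := one_sub_mul_pos hz t
    have hwr := one_sub_mul_pos hw t
    have h1 := mul_le_mul_of_nonneg_left (hεw t) (mul_nonneg ht0 hz0)
    have h2 := mul_nonneg (mul_nonneg ht0 hw0) hzr.le
    have h3 := mul_pos hε (mul_pos hzr hwr)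
    nlinarith
  rw [integral_add (integrable_of_continuous_unitInterval him)
    (integrable_of_continuous_unitInterval (hre.const_mul ε)), integral_const_mul,
    ← im_integral_unitInterval hc, ← re_integral_unitInterval hc, h0] at hpos
  simp at hpos

/-- The sign of the imaginary part is preserved, so equal values come from the same closed
half-plane. There the difference quotient does not vanish; the lower half reduces to the upper one
by conjugation. -/
theorem kernelTransform_injOn (hν : ν ≠ 0) :
    Set.InjOn (kernelTransform ν) halfPlaneReLtOne := by
  have key : ∀ z w : ℂ, z.re < 1 → w.re < 1 → 0 ≤ z.im → 0 ≤ w.im →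
      kernelTransform ν z = kernelTransform ν w → z = w := by
    intro z w hz hw hz0 hw0 h
    have h1 := kernelTransform_sub (ν := ν) (mem_cutPlane_of_re_lt_one hz)
      (mem_cutPlane_of_re_lt_one hw)
    rw [h, sub_self] at h1
    exact sub_eq_zero.1 ((mul_eq_zero.1 h1.symm).resolve_right
      (integral_inv_one_sub_mul_mul_ne_zero hν hz hw hz0 hw0))
  intro z hz w hw h
  have him := congrArg Complex.im h
  rcases lt_or_ge z.im 0 with hz0 | hz0
  · have hw0 : w.im < 0 := by
      by_contra! hw0
      have h1 := kernelTransform_im_neg hν hz0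
      rcases hw0.eq_or_lt with h2 | h2
      · linarith [kernelTransform_im_eq_zero (ν := ν) h2.symm]
      · linarith [kernelTransform_im_pos hν h2]
    have h3 : conj z = conj w := key _ _ hz hw (by simpa using hz0.le) (by simpa using hw0.le)
      (by rw [kernelTransform_conj, kernelTransform_conj, h])
    exact (starRingEnd ℂ).injective h3
  · have hw0 : 0 ≤ w.im := by
      by_contra! hw0
      have h1 := kernelTransform_im_neg hν hw0
      rcases hz0.eq_or_lt with h2 | h2
      · linarith [kernelTransform_im_eq_zero (ν := ν) h2.symm]
      · linarith [kernelTransform_im_pos hν h2]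
    exact key z w hz hw hz0 hw0 h

/-- Already the integrand is positive: its sign is that of `(1 - tx)² - t²|z - x|²`, and `|z - x| <
1 - x` with `t(1 - x) ≤ 1 - tx`. Geometrically, the real part of the transform decreases strictly
along upper semicircles about `x`. -/
theorem im_sub_mul_deriv_kernelTransform_pos (hν : ν ≠ 0) {x : ℝ} {z : ℂ} (hz0 : 0 < z.im)
    (hz : ‖z - x‖ < 1 - x) :
    0 < ((z - x) * ∫ t : unitInterval, ((1 - (t : ℂ) * z) * (1 - (t : ℂ) * z))⁻¹ ∂ν).im := by
  have hz' := mem_cutPlane_of_im_ne_zero hz0.ne'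
  have hc := continuous_inv_one_sub_mul_mul hz' hz'
  rw [← integral_const_mul, im_integral_unitInterval (by fun_prop)]
  refine integral_pos_of_continuous_unitInterval hν (by fun_prop) fun t => ?_
  have ht0 := t.2.1
  have ht1 := t.2.2
  have hne := mul_self_ne_zero.2 (one_sub_mul_ne_zero hz' t)
  have hsq : (z.re - x) ^ 2 + z.im ^ 2 < (1 - x) ^ 2 := by
    have h1 := pow_lt_pow_left₀ hz (norm_nonneg _) two_ne_zero
    rw [Complex.sq_norm, Complex.normSq_apply] at h1
    simp only [Complex.sub_re, Complex.sub_im, Complex.ofReal_re, Complex.ofReal_im, sub_zero] at h1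
    linarith
  have hx : 0 < 1 - x := (norm_nonneg _).trans_lt hz
  have hκ : t * (1 - x) ≤ 1 - t * x := by nlinarith
  have hlt : t ^ 2 * ((z.re - x) ^ 2 + z.im ^ 2) < (1 - t * x) ^ 2 := by
    rcases ht0.eq_or_lt with h | h
    · rw [← h]
      norm_num
    · calc _ < (t : ℝ) ^ 2 * (1 - x) ^ 2 := by gcongr
        _ = (t * (1 - x)) ^ 2 := by ring
        _ ≤ _ := by gcongr
  have hid : ((z - x) * ((1 - (t : ℂ) * z) * (1 - (t : ℂ) * z))⁻¹).im =
      z.im * ((1 - t * x) ^ 2 - t ^ 2 * ((z.re - x) ^ 2 + z.im ^ 2)) /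
        Complex.normSq ((1 - (t : ℂ) * z) * (1 - (t : ℂ) * z)) := by
    rw [Complex.mul_im, Complex.inv_im, Complex.inv_re, ← mul_div_assoc, ← mul_div_assoc, ← add_div]
    congr 1
    simp only [Complex.mul_im, Complex.mul_re, Complex.sub_re, Complex.sub_im, Complex.one_re,
      Complex.one_im, Complex.ofReal_re, Complex.ofReal_im, zero_mul, sub_zero, add_zero, zero_sub]
    ring
  rw [hid]
  exact div_pos (mul_pos hz0 (by linarith)) (Complex.normSq_pos.2 hne)

end KernelTransform

/-! ### Vertical convexity of the images -/

section KernelTransformImage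

variable {ν : Measure unitInterval} [IsFiniteMeasure ν]

theorem kernelTransform_analyticOnNhd : AnalyticOnNhd ℂ (kernelTransform ν) cutPlane :=
  DifferentiableOn.analyticOnNhd
    (fun _ hz => (hasDerivAt_kernelTransform hz).differentiableAt.differentiableWithinAt)
    isOpen_cutPlane

/-- Moving vertically downwards in the image corresponds to moving towards the centre `x` in the
upper half of the disk. -/
theorem exists_kernelTransform_eq_sub_mul_I (hν : ν ≠ 0) {x : ℝ} {z : ℂ} (hz0 : 0 < z.im)
    (hz : ‖z - x‖ < 1 - x) {s : ℝ} (hs0 : 0 ≤ s) (hs : s ≤ (kernelTransform ν z).im) :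
    ∃ w : ℂ, ‖w - x‖ ≤ ‖z - x‖ ∧ kernelTransform ν w = kernelTransform ν z - s * Complex.I := by
  set f := kernelTransform ν with hf
  set K : Set ℂ := Metric.closedBall (x : ℂ) ‖z - x‖ ∩ {w | 0 ≤ w.im} with hK_def
  have hK : IsCompact K :=
    (isCompact_closedBall _ _).inter_right (isClosed_le continuous_const Complex.continuous_im)
  have hKcut : K ⊆ cutPlane := by
    intro w hw
    refine mem_cutPlane_of_re_lt_one ?_
    have h1 : ‖w - x‖ ≤ ‖z - x‖ := by simpa [dist_eq_norm] using hw.1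
    have h2 := Complex.re_le_norm (w - x)
    simp only [Complex.sub_re, Complex.ofReal_re] at h2
    linarith
  have hfK : IsClosed (f '' K) :=
    (hK.image_of_continuousOn (kernelTransform_analyticOnNhd.continuousOn.mono hKcut)).isClosed
  set S : Set ℝ := {r | f z - r * Complex.I ∈ f '' K} with hS_def
  have hS : IsClosed S := hfK.preimage (by fun_prop)
  have hsub : Set.Icc 0 (f z).im ⊆ S := by
    -- Continuous induction on the depth `r`: the attained depths form a closed set, since `K` is
    -- compact, and any attained `r < (f z).im` can be exceeded.
    refine (hS.inter isClosed_Icc).Icc_subset_of_forall_exists_gt ?_ ?_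
    · exact ⟨z, ⟨by simp [dist_eq_norm], hz0.le⟩, by simp⟩
    · rintro r ⟨⟨w, ⟨hw1, hw2⟩, hw3⟩, hr0, hr1⟩ y hy
      have hwz : ‖w - x‖ ≤ ‖z - x‖ := by simpa [dist_eq_norm] using hw1
      have hw0 : 0 < w.im := by
        -- A real `w` would have a real image, but `f w` has imaginary part `(f z).im - r > 0`.
        refine lt_of_le_of_ne hw2 fun h => ?_
        have h1 := kernelTransform_im_eq_zero (ν := ν) h.symm
        rw [← hf, hw3] at h1
        simp at h1
        linarith
      have hm := im_sub_mul_deriv_kernelTransform_pos hν (x := x) hw0 (hwz.trans_lt hz)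
      have hwcut := mem_cutPlane_of_im_ne_zero hw0.ne'
      have hd := hasDerivAt_kernelTransform (ν := ν) hwcut
      set d := ∫ t : unitInterval, ((1 - (t : ℂ) * w) * (1 - (t : ℂ) * w))⁻¹ ∂ν
      have hd0 : d ≠ 0 := by
        rintro h
        rw [h] at hm
        simp at hm
      have hstrict : HasStrictDerivAt f d w := by
        have h1 := (kernelTransform_analyticOnNhd (ν := ν) w hwcut).hasStrictDerivAt
        rwa [hd.deriv] at h1
      set G := hstrict.localInverse f d w hd0
      have hG : HasStrictDerivAt G d⁻¹ (f w) := hstrict.to_localInverse hd0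
      have hGw : G (f w) = w := HasStrictFDerivAt.localInverse_apply_image _
      have hfG : ∀ᶠ u in nhds (f w), f (G u) = u := HasStrictFDerivAt.eventually_right_inverse _
      -- The lift of the downward segment through the local inverse. The derivative of `‖η - x‖²` at
      -- `0` is `-2 Im((w - x) d) / |d|² < 0`, so the lift enters the disk.
      let η : ℝ → ℂ := fun ε => G (f w - ε * Complex.I)
      have hη0 : η 0 = w := by simp [η, hGw]
      have hline : HasDerivAt (fun ε : ℝ => f w - ε * Complex.I) (-Complex.I) 0 := by
        simpa using ((Complex.ofRealCLM.hasDerivAt (x := 0)).mul_const Complex.I).const_sub (f w)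
      have hη : HasDerivAt η (d⁻¹ * -Complex.I) 0 := by
        refine HasDerivAt.comp (h₂ := G) 0 ?_ hline
        simpa using hG.hasDerivAt
      have hnorm : HasDerivAt (fun ε => ‖η ε - x‖ ^ 2)
          (2 * inner ℝ (w - x) (d⁻¹ * -Complex.I)) 0 := by
        simpa [hη0] using (hη.sub_const (x : ℂ)).norm_sq
      have hneg : 2 * inner ℝ (w - x) (d⁻¹ * -Complex.I) < 0 := by
        have h1 : inner ℝ (w - x) (d⁻¹ * -Complex.I) =
            -((w - x) * d).im / Complex.normSq d := by
          rw [Complex.inner, Complex.inv_def]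
          simp [Complex.mul_re, Complex.mul_im]
          ring
        rw [h1, neg_div]
        linarith [div_pos hm (Complex.normSq_pos.2 hd0)]
      have hdec : ∀ᶠ ε in nhdsWithin 0 (Set.Ioi (0 : ℝ)), ‖η ε - x‖ ^ 2 < ‖η 0 - x‖ ^ 2 := by
        filter_upwards [hnorm.hasDerivWithinAt.limsup_slope_le' (lt_irrefl (0 : ℝ)) hneg,
          self_mem_nhdsWithin] with ε hε hε0
        rw [slope_def_field, sub_zero, div_neg_iff] at hε
        have hε0 : 0 < ε := hε0
        rcases hε with h | h <;> linarith
      have hcont : Filter.Tendsto (fun ε : ℝ => f w - ε * Complex.I) (nhds 0) (nhds (f w)) := by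
        simpa using hline.continuousAt.tendsto
      have him : ∀ᶠ ε in nhds (0 : ℝ), 0 < (η ε).im :=
        (Complex.continuous_im.continuousAt.comp hη.continuousAt).eventually_const_lt
          (by simpa [hη0] using hw0)
      have hlt : ∀ᶠ ε in nhds (0 : ℝ), ε < y - r := eventually_lt_nhds (sub_pos.2 hy)
      obtain ⟨ε, ⟨⟨⟨h1, h2⟩, h3⟩, h4⟩, h5⟩ :=
        ((((hdec.and (nhdsWithin_le_nhds (hcont.eventually hfG))).and
          (nhdsWithin_le_nhds him)).and (nhdsWithin_le_nhds hlt)).and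
            self_mem_nhdsWithin).exists
      refine ⟨r + ε, ⟨η ε, ⟨?_, h3.le⟩, ?_⟩, lt_add_of_pos_right _ h5, by linarith⟩
      · rw [hη0] at h1
        have h6 := lt_of_pow_lt_pow_left₀ 2 (norm_nonneg _) h1
        simpa [dist_eq_norm] using h6.le.trans hwz
      · rw [h2, hw3]
        push_cast
        ring
  obtain ⟨w, hw, hfw⟩ := hsub ⟨hs0, hs⟩
  exact ⟨w, by simpa [dist_eq_norm] using hw.1, hfw⟩

/-- The disk is symmetric in the real axis and the transform commutes with conjugation, so
descending from points of the upper half suffices. -/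
theorem kernelTransform_image_vertical (hν : ν ≠ 0) {x : ℝ} {z : ℂ}
    (hz : z ∈ Metric.ball (x : ℂ) (1 - x)) {y : ℝ} (hy : |y| ≤ |(kernelTransform ν z).im|) :
    ((kernelTransform ν z).re : ℂ) + y * Complex.I ∈
      kernelTransform ν '' Metric.ball (x : ℂ) (1 - x) := by
  have hball : ∀ w : ℂ, w ∈ Metric.ball (x : ℂ) (1 - x) → conj w ∈ Metric.ball (x : ℂ) (1 - x) := by
    intro w hw
    rw [Metric.mem_ball, dist_eq_norm] at hw ⊢
    rwa [← Complex.norm_conj, map_sub, Complex.conj_conj, Complex.conj_ofReal]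
  have hupper : ∀ w ∈ Metric.ball (x : ℂ) (1 - x), 0 < w.im →
      ∀ u : ℝ, 0 ≤ u → u ≤ (kernelTransform ν w).im →
      ((kernelTransform ν w).re : ℂ) + u * Complex.I ∈
        kernelTransform ν '' Metric.ball (x : ℂ) (1 - x) := by
    intro w hw hw0 u hu0 hu
    rw [Metric.mem_ball, dist_eq_norm] at hw
    obtain ⟨v, hv, hfv⟩ := exists_kernelTransform_eq_sub_mul_I hν hw0 hw
      (sub_nonneg.2 hu) (sub_le_self _ hu0)
    refine ⟨v, by simpa [dist_eq_norm] using hv.trans_lt hw, ?_⟩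
    rw [hfv]
    apply Complex.ext <;> simp
  have habs : ((kernelTransform ν z).re : ℂ) + |y| * Complex.I ∈
      kernelTransform ν '' Metric.ball (x : ℂ) (1 - x) := by
    rcases lt_trichotomy z.im 0 with h | h | h
    · have h1 := kernelTransform_im_neg hν h
      have h2 := hupper (conj z) (hball z hz) (by simpa using h) |y| (abs_nonneg y)
      rw [kernelTransform_conj] at h2
      simpa [abs_of_neg h1] using h2 (by simpa [abs_of_neg h1] using hy)
    · have h1 := kernelTransform_im_eq_zero (ν := ν) h
      rw [h1, abs_zero] at hy
      refine ⟨z, hz, ?_⟩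
      rw [le_antisymm hy (abs_nonneg y)]
      apply Complex.ext <;> simp [h1]
    · have h1 := kernelTransform_im_pos hν h
      rw [abs_of_pos h1] at hy
      exact hupper z hz h |y| (abs_nonneg y) hy
  rcases abs_cases y with ⟨h, -⟩ | ⟨h, -⟩
  · rwa [h] at habs
  · obtain ⟨w, hw, hfw⟩ := habs
    refine ⟨conj w, hball w hw, ?_⟩
    rw [kernelTransform_conj, hfw, h]
    simp

/-- Containing with each point the vertical segment to its conjugate is inherited by unions, so a
cover of `S` by disks inside `S` is enough. Such a set has convex vertical sections: a height
between two attained ones is no larger in modulus than one of them. -/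
theorem mapsUnivalentlyOntoConvexImag_of_kernelTransform (hν : ν ≠ 0) {C : ℝ} {f : ℂ → ℂ}
    (hf : Set.EqOn f (fun z => C + kernelTransform ν z) cutPlane) {S : Set ℂ} (hSo : IsOpen S)
    (hSc : IsConnected S) (hS : S ⊆ halfPlaneReLtOne)
    (hdisk : ∀ z ∈ S, ∃ x : ℝ, z ∈ Metric.ball (x : ℂ) (1 - x) ∧ Metric.ball (x : ℂ) (1 - x) ⊆ S) :
    MapsUnivalentlyOntoConvexImag f S := by
  have hScut := hS.trans halfPlaneReLtOne_subset_cutPlane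
  have hfa : AnalyticOnNhd ℂ f cutPlane :=
    (analyticOnNhd_const.add kernelTransform_analyticOnNhd).congr isOpen_cutPlane hf.symm
  have hinj : Set.InjOn f S := by
    intro z hz w hw h
    rw [hf (hScut hz), hf (hScut hw)] at h
    exact kernelTransform_injOn hν (hS hz) (hS hw) (add_left_cancel h)
  have hvert : ∀ w ∈ f '' S, ∀ y : ℝ, |y| ≤ |w.im| → (w.re : ℂ) + y * Complex.I ∈ f '' S := by
    rintro _ ⟨z, hz, rfl⟩ y hy
    obtain ⟨x, hzx, hxS⟩ := hdisk z hz
    rw [hf (hScut hz)] at hy ⊢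
    obtain ⟨v, hv, hfv⟩ := kernelTransform_image_vertical hν hzx (y := y) (by simpa using hy)
    refine ⟨v, hxS hv, ?_⟩
    rw [hf (hScut (hxS hv))]
    simp only [hfv]
    apply Complex.ext <;> simp
  refine ⟨hfa.mono hScut, hinj, ?_, ?_, ?_⟩
  · rcases (hfa.mono hScut).is_constant_or_isOpen hSc.isPreconnected with ⟨w, hw⟩ | h
    · obtain ⟨z, hz⟩ := hSc.nonempty
      have : S = {z} := Set.Subset.antisymm
        (fun u hu => hinj hu hz ((hw u hu).trans (hw z hz).symm)) (by simpa using hz)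
      rw [this] at hSo
      exact absurd hSo (not_isOpen_singleton z)
    · exact h S le_rfl hSo
  · exact hSc.image f (hfa.mono hScut).continuousOn
  · intro x
    have hconv : Convex ℝ {y : ℝ | (x : ℂ) + y * Complex.I ∈ f '' S} := by
      refine Set.OrdConnected.convex ⟨fun y₁ h₁ y₂ h₂ y hy => ?_⟩
      rcases le_total 0 y with h | h
      · have := hvert _ h₂ y (by
          simp only [Complex.add_im, Complex.ofReal_im, Complex.im_ofReal_mul, Complex.I_im,
            mul_one, zero_add]
          rw [abs_of_nonneg h, abs_of_nonneg (h.trans hy.2)]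
          exact hy.2)
        simpa using this
      · have := hvert _ h₁ y (by
          simp only [Complex.add_im, Complex.ofReal_im, Complex.im_ofReal_mul, Complex.I_im,
            mul_one, zero_add]
          rw [abs_of_nonpos h, abs_of_nonpos (hy.1.trans h)]
          linarith [hy.1])
        simpa using this
    have himage : f '' S ∩ {w : ℂ | w.re = x} =
        (fun y : ℝ => (x : ℂ) + y * Complex.I) '' {y : ℝ | (x : ℂ) + y * Complex.I ∈ f '' S} := by
      ext w
      constructor
      · rintro ⟨hw, rfl⟩
        exact ⟨w.im, by simpa [Complex.re_add_im] using hw, Complex.re_add_im w⟩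
      · rintro ⟨y, hy, rfl⟩
        exact ⟨hy, by simp⟩
    rw [himage]
    exact hconv.isPreconnected.image _ (by fun_prop)

theorem hasMappingProperty_of_kernelTransform (hν : ν ≠ 0) {C : ℝ} {f : ℂ → ℂ}
    (hf : Set.EqOn f (fun z => C + kernelTransform ν z) cutPlane) : HasMappingProperty f := by
  have hball : ∀ x : ℝ, Metric.ball (x : ℂ) (1 - x) ⊆ halfPlaneReLtOne := by
    intro x z hz
    rw [Metric.mem_ball, dist_eq_norm] at hz
    have h := Complex.re_le_norm (z - x)
    simp only [Complex.sub_re, Complex.ofReal_re] at h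
    change z.re < 1
    linarith
  constructor
  · refine mapsUnivalentlyOntoConvexImag_of_kernelTransform hν hf Metric.isOpen_ball
      ((convex_ball _ _).isConnected (Metric.nonempty_ball.2 one_pos)) ?_ fun z hz => ⟨0, ?_⟩
    · simpa using hball 0
    · simpa using hz
  · refine mapsUnivalentlyOntoConvexImag_of_kernelTransform hν hf
      (isOpen_lt Complex.continuous_re continuous_const)
      ((convex_halfSpace_re_lt 1).isConnected ⟨0, by simp⟩) le_rfl fun z hz => ?_
    have hz : z.re < 1 := hz
    have hδ : 0 < 1 - z.re := sub_pos.2 hz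
    -- With `x = z.re - q` and `δ = 1 - z.re` one gets `(1 - x)² - |z - x|² = δ² + 2δq - z.im² = δ²
    -- + z.im² > 0`.
    obtain ⟨q, hq0, hq⟩ : ∃ q : ℝ, 0 ≤ q ∧ (1 - z.re) * q = z.im ^ 2 :=
      ⟨z.im ^ 2 / (1 - z.re), by positivity, mul_div_cancel₀ _ hδ.ne'⟩
    refine ⟨z.re - q, ?_, hball _⟩
    rw [Metric.mem_ball, dist_eq_norm]
    refine lt_of_pow_lt_pow_left₀ 2 (by linarith) ?_
    rw [Complex.sq_norm, Complex.normSq_apply]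
    simp only [Complex.sub_re, Complex.sub_im, Complex.ofReal_re, Complex.ofReal_im, sub_zero]
    nlinarith [mul_pos hδ hδ, sq_nonneg z.im]

end KernelTransformImage

/-! ### Contiguous relations and Gauss' continued fraction -/

/-- The formal hypergeometric series with real parameters. -/
noncomputable def hypergeometricPowerSeries (a b c : ℝ) : PowerSeries ℝ :=
  PowerSeries.mk (ordinaryHypergeometricCoefficient a b c)

theorem ascPochhammer_succ_eval_left (n : ℕ) (x : ℝ) :
    (ascPochhammer ℝ (n + 1)).eval x = x * (ascPochhammer ℝ n).eval (x + 1) := by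
  simp [ascPochhammer_succ_left, Polynomial.eval_comp]

theorem hypergeometricPowerSeries_symm (a b c : ℝ) :
    hypergeometricPowerSeries a b c = hypergeometricPowerSeries b a c := by
  ext n
  simp only [hypergeometricPowerSeries, PowerSeries.coeff_mk, ordinaryHypergeometricCoefficient]
  ring

theorem hypergeometricPowerSeries_constantCoeff (a b c : ℝ) :
    PowerSeries.constantCoeff (hypergeometricPowerSeries a b c) = 1 := by
  simp [hypergeometricPowerSeries, ← PowerSeries.coeff_zero_eq_constantCoeff_apply,
    ordinaryHypergeometricCoefficient]

theorem hypergeometricPowerSeries_succ_middle (a b : ℝ) {c : ℝ} (hc : 0 < c) :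
    hypergeometricPowerSeries a (b + 1) c = hypergeometricPowerSeries a b c +
      PowerSeries.C (a / c) * PowerSeries.X *
        hypergeometricPowerSeries (a + 1) (b + 1) (c + 1) := by
  ext n
  rcases n with _ | n
  · simp [hypergeometricPowerSeries_constantCoeff, mul_assoc]
  · rw [map_add, mul_assoc, PowerSeries.coeff_C_mul, PowerSeries.coeff_succ_X_mul]
    simp only [hypergeometricPowerSeries, PowerSeries.coeff_mk, ordinaryHypergeometricCoefficient]
    rw [ascPochhammer_succ_eval n (b + 1), ascPochhammer_succ_eval_left n a,
      ascPochhammer_succ_eval_left n b, ascPochhammer_succ_eval_left n c, Nat.factorial_succ]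
    have h1 := (ascPochhammer_pos n (c + 1) (by linarith)).ne'
    have h2 : (n.factorial : ℝ) ≠ 0 := by exact_mod_cast n.factorial_ne_zero
    have h3 : (n : ℝ) + 1 ≠ 0 := by positivity
    push_cast
    field_simp
    ring

theorem hypergeometricPowerSeries_succ_left_right (a b : ℝ) {c : ℝ} (hc : 0 < c) :
    hypergeometricPowerSeries (a + 1) b (c + 1) = hypergeometricPowerSeries a b c +
      PowerSeries.C (b * (c - a) / (c * (c + 1))) * PowerSeries.X *
        hypergeometricPowerSeries (a + 1) (b + 1) (c + 2) := by
  ext n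
  rcases n with _ | n
  · simp [hypergeometricPowerSeries_constantCoeff, mul_assoc]
  · rw [map_add, mul_assoc, PowerSeries.coeff_C_mul, PowerSeries.coeff_succ_X_mul]
    simp only [hypergeometricPowerSeries, PowerSeries.coeff_mk, ordinaryHypergeometricCoefficient]
    have h4 : (ascPochhammer ℝ n).eval (c + 1) * (c + 1 + n) =
        (c + 1) * (ascPochhammer ℝ n).eval (c + 2) := by
      rw [← ascPochhammer_succ_eval, ascPochhammer_succ_eval_left, add_assoc, one_add_one_eq_two]
    have h5 : (ascPochhammer ℝ n).eval (c + 2) =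
        (ascPochhammer ℝ n).eval (c + 1) * (c + 1 + n) / (c + 1) := by
      rw [h4]
      field_simp
    rw [h5, ascPochhammer_succ_eval n (a + 1), ascPochhammer_succ_eval_left n a,
      ascPochhammer_succ_eval_left n b, ascPochhammer_succ_eval_left n c,
      ascPochhammer_succ_eval n (c + 1), Nat.factorial_succ]
    have h1 := (ascPochhammer_pos n (c + 1) (by linarith)).ne'
    have h2 : (n.factorial : ℝ) ≠ 0 := by exact_mod_cast n.factorial_ne_zero
    have h3 : (n : ℝ) + 1 ≠ 0 := by positivity
    have h6 : c + 1 + n ≠ 0 := by positivity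
    push_cast
    field_simp
    ring

theorem hypergeometricPowerSeries_succ_middle_right (a b : ℝ) {c : ℝ} (hc : 0 < c) :
    hypergeometricPowerSeries a (b + 1) (c + 1) = hypergeometricPowerSeries a b c +
      PowerSeries.C (a * (c - b) / (c * (c + 1))) * PowerSeries.X *
        hypergeometricPowerSeries (a + 1) (b + 1) (c + 2) := by
  rw [hypergeometricPowerSeries_symm a, hypergeometricPowerSeries_succ_left_right b a hc,
    hypergeometricPowerSeries_symm b, hypergeometricPowerSeries_symm (b + 1)]

/-- Gauss' chain of contiguous hypergeometric series. -/
noncomputable def gaussChain (a b c : ℝ) (k : ℕ) : PowerSeries ℝ :=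
  if k = 0 then hypergeometricPowerSeries (a + 1) b (c + 1)
  else hypergeometricPowerSeries (a + 1 + (k / 2 : ℕ)) (b + ((k + 1) / 2 : ℕ)) (c + k)

/-- The parameters of the chain sequence in Gauss' continued fraction. -/
noncomputable def gaussParam (a b c : ℝ) (k : ℕ) : ℝ :=
  if k = 0 then 0
  else if k % 2 = 1 then (a + 1 + (k / 2 : ℕ)) / (c + k) else (b + (k / 2 : ℕ)) / (c + k)

/-- The parameter restrictions enter here: `-1 < a ≤ c` serves the odd indices and `0 ≤ b ≤ c` the
even ones. -/
theorem gaussParam_mem {a b c : ℝ} (ha : -1 < a) (hac : a ≤ c) (hb : 0 ≤ b) (hbc : b ≤ c) (k : ℕ) :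
    gaussParam a b c k ∈ unitInterval := by
  unfold gaussParam
  split_ifs with h0 h1
  · exact ⟨le_rfl, zero_le_one⟩
  · obtain ⟨j, rfl⟩ : ∃ j, k = 2 * j + 1 := ⟨k / 2, by omega⟩
    have hj : (0 : ℝ) ≤ j := j.cast_nonneg
    rw [show (2 * j + 1) / 2 = j by omega]
    push_cast
    constructor
    · exact div_nonneg (by linarith) (by linarith)
    · exact div_le_one_of_le₀ (by linarith) (by linarith)
  · have hc : 0 ≤ c := hb.trans hbc
    have hk : ((k / 2 : ℕ) : ℝ) ≤ k := by exact_mod_cast Nat.div_le_self k 2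
    constructor
    · exact div_nonneg (by positivity) (by positivity)
    · exact div_le_one_of_le₀ (by linarith) (by positivity)

/-- Steps of the chain alternately raise the left and the middle parameter, each time with the right
one, so the two relations of that kind apply in turn. -/
theorem gaussChain_succ {a b c : ℝ} (hc : 0 ≤ c) (k : ℕ) :
    gaussChain a b c (k + 1) = gaussChain a b c k +
      PowerSeries.C ((1 - gaussParam a b c k) * gaussParam a b c (k + 1)) * PowerSeries.X *
        gaussChain a b c (k + 2) := by
  rcases k with _ | k
  -- The first step is exceptional: only the middle parameter is raised. The value `0` of the
  -- parameter at index `0` makes the coefficient exactly `(a + 1) / (c + 1)`.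
  · have h := hypergeometricPowerSeries_succ_middle (a + 1) b (c := c + 1) (by linarith)
    simp only [gaussChain, gaussParam]
    norm_num
    convert h using 4
    all_goals ring_nf
  obtain ⟨j, rfl | rfl⟩ : ∃ j, k = 2 * j ∨ k = 2 * j + 1 := ⟨k / 2, by omega⟩
  · have hj : (0 : ℝ) ≤ j := j.cast_nonneg
    have h := hypergeometricPowerSeries_succ_left_right (a + 1 + j) (b + 1 + j) (c := c + 1 + 2 * j)
      (by linarith)
    have hcoef : (1 - gaussParam a b c (2 * j + 1)) * gaussParam a b c (2 * j + 1 + 1) =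
        (b + 1 + j) * (c + 1 + 2 * j - (a + 1 + j)) / ((c + 1 + 2 * j) * (c + 1 + 2 * j + 1)) := by
      have h1 : c + 1 + 2 * j ≠ 0 := by positivity
      have h2 : c + 1 + 2 * j + 1 ≠ 0 := by positivity
      simp only [gaussParam]
      rw [if_neg (by omega), if_pos (by omega), if_neg (by omega), if_neg (by omega),
        show (2 * j + 1) / 2 = j by omega, show (2 * j + 1 + 1) / 2 = j + 1 by omega]
      push_cast
      rw [show c + (2 * j + 1) = c + 1 + 2 * (j : ℝ) by ring,
        show c + (2 * j + 1 + 1) = c + 1 + 2 * (j : ℝ) + 1 by ring]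
      field_simp
      ring
    rw [hcoef]
    simp only [gaussChain]
    rw [if_neg (by omega), if_neg (by omega), if_neg (by omega),
      show (2 * j + 1 + 1) / 2 = j + 1 by omega, show (2 * j + 1) / 2 = j by omega,
      show (2 * j + 1 + 1 + 1) / 2 = j + 1 by omega,
      show (2 * j + 1 + 2 + 1) / 2 = j + 2 by omega]
    push_cast
    convert h using 2
    all_goals ring_nf
  · have hj : (0 : ℝ) ≤ j := j.cast_nonneg
    have h := hypergeometricPowerSeries_succ_middle_right (a + 2 + j) (b + 1 + j)
      (c := c + 2 + 2 * j) (by linarith)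
    have hcoef : (1 - gaussParam a b c (2 * j + 1 + 1)) * gaussParam a b c (2 * j + 1 + 1 + 1) =
        (a + 2 + j) * (c + 2 + 2 * j - (b + 1 + j)) / ((c + 2 + 2 * j) * (c + 2 + 2 * j + 1)) := by
      have h1 : c + 2 + 2 * j ≠ 0 := by positivity
      have h2 : c + 2 + 2 * j + 1 ≠ 0 := by positivity
      simp only [gaussParam]
      rw [if_neg (by omega), if_neg (by omega), if_neg (by omega), if_pos (by omega),
        show (2 * j + 1 + 1) / 2 = j + 1 by omega, show (2 * j + 1 + 1 + 1) / 2 = j + 1 by omega]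
      push_cast
      rw [show c + (2 * j + 1 + 1) = c + 2 + 2 * (j : ℝ) by ring,
        show c + (2 * j + 1 + 1 + 1) = c + 2 + 2 * (j : ℝ) + 1 by ring]
      field_simp
      ring
    rw [hcoef]
    simp only [gaussChain]
    rw [if_neg (by omega), if_neg (by omega), if_neg (by omega),
      show (2 * j + 1 + 1 + 1) / 2 = j + 1 by omega, show (2 * j + 1 + 1) / 2 = j + 1 by omega,
      show (2 * j + 1 + 1 + 1 + 1) / 2 = j + 2 by omega,
      show (2 * j + 1 + 1 + 2 + 1) / 2 = j + 2 by omega]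
    push_cast
    convert h using 2
    all_goals ring_nf

theorem exists_measure_first_ratio {a b c : ℝ} (ha : -1 < a) (hac : a ≤ c) (hb : 0 ≤ b)
    (hbc : b ≤ c) :
    ∃ μ : Measure unitInterval, IsProbabilityMeasure μ ∧
      hypergeometricPowerSeries (a + 1) (b + 1) (c + 1) =
        hypergeometricPowerSeries (a + 1) b (c + 1) *
          PowerSeries.mk fun n => ∫ t : unitInterval, (t : ℝ) ^ n ∂μ := by
  have h := exists_measure_of_chainSequence (gaussParam a b c) (gaussParam_mem ha hac hb hbc)
    (gaussChain a b c) (by simp [gaussChain, hypergeometricPowerSeries_constantCoeff])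
    (gaussChain_succ (hb.trans hbc))
  simpa [gaussChain] using h

/-- The tail of a chain sequence is again one, with the shifted parameters. -/
theorem exists_measure_last_ratio {a b c : ℝ} (ha : -1 < a) (hac : a ≤ c) (hb : 0 ≤ b)
    (hbc : b ≤ c) :
    ∃ μ : Measure unitInterval, IsProbabilityMeasure μ ∧
      hypergeometricPowerSeries (a + 2) (b + 1) (c + 2) =
        hypergeometricPowerSeries (a + 1) (b + 1) (c + 1) *
          PowerSeries.mk fun n => ∫ t : unitInterval, (t : ℝ) ^ n ∂μ := by
  have h := exists_measure_of_chainSequence (fun k => gaussParam a b c (k + 1))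
    (fun k => gaussParam_mem ha hac hb hbc (k + 1)) (fun k => gaussChain a b c (k + 1))
    (by simp [gaussChain, hypergeometricPowerSeries_constantCoeff])
    (fun k => gaussChain_succ (hb.trans hbc) (k + 1))
  simpa [gaussChain, add_assoc, one_add_one_eq_two] using h

/-! ### From formal series to functions on the unit disk -/

theorem ascPochhammer_eval_ofReal (n : ℕ) (x : ℝ) :
    (ascPochhammer ℂ n).eval (x : ℂ) = ((ascPochhammer ℝ n).eval x : ℝ) := by
  induction n with
  | zero => simp
  | succ n ih => simp [ascPochhammer_succ_eval, ih]

/-- The value of a formal power series with real coefficients at a complex point. -/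
noncomputable def seriesValue (p : PowerSeries ℝ) (ω : ℂ) : ℂ :=
  ∑' n, ((PowerSeries.coeff n p : ℝ) : ℂ) * ω ^ n

/-- Absolute convergence of a formal power series with real coefficients at `ω`. -/
def SummableAt (p : PowerSeries ℝ) (ω : ℂ) : Prop :=
  Summable fun n => ‖((PowerSeries.coeff n p : ℝ) : ℂ) * ω ^ n‖

theorem seriesValue_mul {p q : PowerSeries ℝ} {ω : ℂ} (hp : SummableAt p ω)
    (hq : SummableAt q ω) : seriesValue (p * q) ω = seriesValue p ω * seriesValue q ω := by
  rw [seriesValue, seriesValue, seriesValue,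
    tsum_mul_tsum_eq_tsum_sum_antidiagonal_of_summable_norm hp hq]
  refine tsum_congr fun n => ?_
  rw [PowerSeries.coeff_mul, Complex.ofReal_sum, Finset.sum_mul]
  refine Finset.sum_congr rfl fun k hk => ?_
  rw [← Finset.HasAntidiagonal.mem_antidiagonal.1 hk, pow_add, Complex.ofReal_mul]
  ring

theorem ordinaryHypergeometric_eq_seriesValue (a b c : ℝ) (ω : ℂ) :
    ordinaryHypergeometric (a : ℂ) (b : ℂ) (c : ℂ) ω =
      seriesValue (hypergeometricPowerSeries a b c) ω := by
  rw [ordinaryHypergeometric_eq_tsum, seriesValue]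
  refine tsum_congr fun n => ?_
  simp [hypergeometricPowerSeries, ascPochhammer_eval_ofReal, ordinaryHypergeometricCoefficient]

theorem summableAt_hypergeometricPowerSeries {a b c : ℝ} (ha : 0 < a) (hb : 0 ≤ b) (hc : 0 < c)
    {ω : ℂ} (hω : ‖ω‖ < 1) : SummableAt (hypergeometricPowerSeries a b c) ω := by
  have hr : 1 ≤ (ordinaryHypergeometricSeries ℂ (a : ℂ) (b : ℂ) (c : ℂ)).radius := by
    -- For `b = 0` the series terminates and its radius is infinite, not one.
    rcases hb.eq_or_lt with rfl | hb
    · have h := ordinaryHypergeometric_radius_top_of_neg_nat₂ ℂ (a : ℂ) (c : ℂ) (k := 0)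
      simp only [Nat.cast_zero, neg_zero] at h
      rw [Complex.ofReal_zero, h]
      exact le_top
    · refine (ordinaryHypergeometricSeries_radius_eq_one ℂ (a : ℂ) (b : ℂ) (c : ℂ) ?_).ge
      have key : ∀ (k : ℕ) (x : ℝ), 0 < x → (k : ℂ) ≠ -(x : ℂ) := by
        intro k x hx h
        have h1 : (k : ℝ) = -x := by exact_mod_cast h
        have h2 : (0 : ℝ) ≤ k := k.cast_nonneg
        linarith
      exact fun k => ⟨key k a ha, key k b hb, key k c hc⟩
  have h := (ordinaryHypergeometricSeries ℂ (a : ℂ) (b : ℂ) (c : ℂ)).summable_norm_apply (x := ω)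
    (Metric.eball_subset_eball hr (by
      simpa [edist_zero_right, enorm_eq_nnnorm, ← NNReal.coe_lt_coe] using hω))
  refine h.congr fun n => ?_
  rw [ordinaryHypergeometricSeries_apply_eq]
  simp [hypergeometricPowerSeries, ascPochhammer_eval_ofReal, ordinaryHypergeometricCoefficient]

theorem hasDerivAt_seriesValue_hypergeometric {a b c : ℝ} (ha : 0 < a) (hb : 0 ≤ b) (hc : 0 < c)
    {ω : ℂ} (hω : ‖ω‖ < 1) :
    HasDerivAt (seriesValue (hypergeometricPowerSeries a b c))
      ((a * b / c : ℝ) * seriesValue (hypergeometricPowerSeries (a + 1) (b + 1) (c + 1)) ω) ω := by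
  -- The differentiated series at `r` majorizes the one on the disk of radius `r`, allowing termwise
  -- differentiation.
  obtain ⟨r, hωr, hr⟩ := exists_between hω
  have hr0 : 0 ≤ r := (norm_nonneg ω).trans hωr.le
  have hcoef : ∀ n : ℕ, PowerSeries.coeff (n + 1) (hypergeometricPowerSeries a b c) * (n + 1 : ℕ) =
      a * b / c * PowerSeries.coeff n (hypergeometricPowerSeries (a + 1) (b + 1) (c + 1)) := by
    intro n
    simp only [hypergeometricPowerSeries, PowerSeries.coeff_mk, ordinaryHypergeometricCoefficient]
    rw [ascPochhammer_succ_eval_left n a, ascPochhammer_succ_eval_left n b,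
      ascPochhammer_succ_eval_left n c, Nat.factorial_succ]
    have h1 := (ascPochhammer_pos n (c + 1) (by linarith)).ne'
    have h2 : (n.factorial : ℝ) ≠ 0 := by exact_mod_cast n.factorial_ne_zero
    have h3 : (n : ℝ) + 1 ≠ 0 := by positivity
    push_cast
    field_simp
  have hterm : ∀ (n : ℕ) (z : ℂ),
      ((PowerSeries.coeff (n + 1) (hypergeometricPowerSeries a b c) : ℝ) : ℂ)
      * (((n + 1 : ℕ) : ℂ) * z ^ n) = ((a * b / c : ℝ) : ℂ) *
        (((PowerSeries.coeff n (hypergeometricPowerSeries (a + 1) (b + 1) (c + 1)) : ℝ) : ℂ)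
          * z ^ n) := by
    intro n z
    rw [← mul_assoc, ← mul_assoc, ← Complex.ofReal_mul, ← hcoef]
    push_cast
    ring
  have hsum : SummableAt (hypergeometricPowerSeries (a + 1) (b + 1) (c + 1)) (r : ℂ) :=
    summableAt_hypergeometricPowerSeries (by linarith) (by linarith) (by linarith)
      (by simpa [abs_of_nonneg hr0] using hr)
  have hsum' : SummableAt (hypergeometricPowerSeries (a + 1) (b + 1) (c + 1)) ω :=
    summableAt_hypergeometricPowerSeries (by linarith) (by linarith) (by linarith) hω
  let g' : ℕ → ℂ → ℂ := fun n z =>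
    ((PowerSeries.coeff n (hypergeometricPowerSeries a b c) : ℝ) : ℂ) * ((n : ℂ) * z ^ (n - 1))
  let u : ℕ → ℝ := fun n => ‖g' n r‖
  have hu : Summable u := by
    rw [← summable_nat_add_iff 1]
    refine (hsum.mul_left ‖((a * b / c : ℝ) : ℂ)‖).congr fun n => ?_
    simp only [u, g', Nat.add_sub_cancel]
    rw [hterm]
    simp only [norm_mul]
  have hmain := hasDerivAt_tsum_of_isPreconnected (𝕜 := ℂ) (F := ℂ) (u := u)
    (g := fun n z => ((PowerSeries.coeff n (hypergeometricPowerSeries a b c) : ℝ) : ℂ) * z ^ n)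
    (g' := g') (t := Metric.ball 0 r) (y₀ := ω) (y := ω) hu Metric.isOpen_ball
    (convex_ball _ _).isPreconnected
    (fun n z _ => by simpa using (hasDerivAt_pow n z).const_mul _)
    (fun n z hz => by
      simp only [u, g', norm_mul, norm_pow, Complex.norm_real, Real.norm_eq_abs, abs_of_nonneg hr0]
      have hz : ‖z‖ < r := by simpa using hz
      gcongr)
    (by simpa using hωr)
    (summableAt_hypergeometricPowerSeries ha hb hc hω).of_norm
    (by simpa using hωr)
  refine hmain.congr_deriv ?_
  have hs : Summable fun n => g' n ω := by
    rw [← summable_nat_add_iff 1]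
    refine (hsum'.of_norm.mul_left ((a * b / c : ℝ) : ℂ)).congr fun n => ?_
    simp only [g', Nat.add_sub_cancel]
    rw [hterm]
  rw [hs.tsum_eq_zero_add, seriesValue, ← tsum_mul_left]
  simp only [g', Nat.cast_zero, zero_mul, mul_zero, zero_add, Nat.add_sub_cancel]
  exact tsum_congr fun n => hterm n ω

theorem summableAt_moments (μ : Measure unitInterval) [IsProbabilityMeasure μ] {ω : ℂ}
    (hω : ‖ω‖ < 1) :
    SummableAt (PowerSeries.mk fun n => ∫ t : unitInterval, (t : ℝ) ^ n ∂μ) ω := by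
  refine Summable.of_nonneg_of_le (fun n => norm_nonneg _) (fun n => ?_)
    (summable_geometric_of_lt_one (norm_nonneg ω) hω)
  rw [PowerSeries.coeff_mk, norm_mul, norm_pow, Complex.norm_real]
  refine mul_le_of_le_one_left (by positivity) ?_
  refine (norm_integral_le_of_norm_le_const (C := 1)
    (Filter.Eventually.of_forall fun t => ?_)).trans (by simp)
  rw [norm_pow, Real.norm_of_nonneg t.2.1]
  exact pow_le_one₀ t.2.1 t.2.2

theorem seriesValue_moments (μ : Measure unitInterval) [IsProbabilityMeasure μ] {ω : ℂ}
    (hω : ‖ω‖ < 1) :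
    seriesValue (PowerSeries.mk fun n => ∫ t : unitInterval, (t : ℝ) ^ n ∂μ) ω =
      ∫ t : unitInterval, 1 / (1 - (t : ℂ) * ω) ∂μ := by
  have hle : ∀ t : unitInterval, ‖(t : ℂ) * ω‖ ≤ ‖ω‖ := fun t => by
    rw [norm_mul, Complex.norm_real, Real.norm_of_nonneg t.2.1]
    exact mul_le_of_le_one_left (norm_nonneg _) t.2.2
  have h := hasSum_integral_of_summable_integral_norm (μ := μ)
    (F := fun (n : ℕ) (t : unitInterval) => ((t : ℂ) * ω) ^ n)
    (fun n => integrable_of_continuous_unitInterval (by fun_prop)) (by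
      refine Summable.of_nonneg_of_le (fun n => integral_nonneg fun t => norm_nonneg _)
        (fun n => ?_) (summable_geometric_of_lt_one (norm_nonneg ω) hω)
      refine (integral_mono (integrable_of_continuous_unitInterval (by fun_prop))
        (integrable_const (‖ω‖ ^ n)) fun t => ?_).trans (by simp)
      beta_reduce
      rw [norm_pow]
      exact pow_le_pow_left₀ (norm_nonneg _) (hle t) n)
  rw [seriesValue]
  calc _ = ∑' n : ℕ, ∫ t : unitInterval, ((t : ℂ) * ω) ^ n ∂μ := by
        refine tsum_congr fun n => ?_
        rw [PowerSeries.coeff_mk, ← integral_complex_ofReal, ← integral_mul_const]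
        simp [mul_pow]
    _ = _ := by
        rw [h.tsum_eq]
        refine integral_congr_ae (Filter.Eventually.of_forall fun t => ?_)
        beta_reduce
        rw [tsum_geometric_of_norm_lt_one ((hle t).trans_lt hω), one_div]

/-! ### Stieltjes transforms on the slit plane -/

/-- The measure `t dμ(t)` on `[0, 1]`. -/
noncomputable def weightedMeasure (μ : Measure unitInterval) : Measure unitInterval :=
  μ.withDensity fun t => (unitInterval.toNNReal t : ENNReal)

theorem integral_weightedMeasure (μ : Measure unitInterval) {E : Type*} [NormedAddCommGroup E]
    [NormedSpace ℝ E] (φ : unitInterval → E) :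
    ∫ t, φ t ∂(weightedMeasure μ) = ∫ t, (t : ℝ) • φ t ∂μ := by
  have hm : Measurable fun t : unitInterval => unitInterval.toNNReal t :=
    unitInterval.toNNReal_continuous.measurable
  exact integral_withDensity_eq_integral_smul hm φ

theorem isFiniteMeasure_weightedMeasure (μ : Measure unitInterval) [IsFiniteMeasure μ] :
    IsFiniteMeasure (weightedMeasure μ) := by
  refine isFiniteMeasure_withDensity (ne_of_lt ?_)
  calc ∫⁻ t, (unitInterval.toNNReal t : ENNReal) ∂μ ≤ ∫⁻ _, 1 ∂μ :=
        lintegral_mono fun t => ENNReal.coe_le_one_iff.2 (NNReal.coe_le_coe.1 t.2.2)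
    _ < ⊤ := by simp

theorem weightedMeasure_ne_zero {μ : Measure unitInterval}
    (h : ∫ t : unitInterval, (t : ℝ) ∂μ ≠ 0) : weightedMeasure μ ≠ 0 := by
  intro h0
  have h1 := integral_weightedMeasure μ (fun _ => (1 : ℝ))
  rw [h0] at h1
  simp at h1
  exact h h1.symm

theorem integral_sq_pos {μ : Measure unitInterval} [IsProbabilityMeasure μ]
    (h : 0 < ∫ t : unitInterval, (t : ℝ) ∂μ) : 0 < ∫ t : unitInterval, (t : ℝ) * (t : ℝ) ∂μ := by
  set m := ∫ t : unitInterval, (t : ℝ) ∂μ with hm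
  -- Integrating `(t - m)² ≥ 0` bounds the second moment below by `m²`.
  have h1 : ∫ t : unitInterval, (2 * m * (t : ℝ) - m ^ 2) ∂μ ≤
      ∫ t : unitInterval, (t : ℝ) * (t : ℝ) ∂μ :=
    integral_mono (integrable_of_continuous_unitInterval (by fun_prop))
      (integrable_of_continuous_unitInterval (by fun_prop))
      fun t => by nlinarith [sq_nonneg ((t : ℝ) - m)]
  rw [integral_sub (integrable_of_continuous_unitInterval (by fun_prop)) (integrable_const _),
    integral_const_mul, ← hm] at h1
  simp at h1
  nlinarith

/-- The transform `z ↦ ∫ dμ(t) / (1 - t z)` of a measure on `[0, 1]`. -/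
noncomputable def stieltjesTransform (μ : Measure unitInterval) (z : ℂ) : ℂ :=
  ∫ t : unitInterval, 1 / (1 - (t : ℂ) * z) ∂μ

section StieltjesTransform

variable {μ : Measure unitInterval}

theorem mul_stieltjesTransform (z : ℂ) : z * stieltjesTransform μ z = kernelTransform μ z := by
  rw [stieltjesTransform, kernelTransform, ← integral_const_mul]
  simp [div_eq_mul_inv]

variable [IsFiniteMeasure μ]

theorem stieltjesTransform_eq {z : ℂ} (hz : z ∈ cutPlane) :
    stieltjesTransform μ z = μ.real Set.univ + kernelTransform (weightedMeasure μ) z := by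
  have h1 : (μ.real Set.univ : ℂ) = ∫ _, (1 : ℂ) ∂μ := by simp
  have hc : Continuous fun t : unitInterval => (t : ℝ) • (z / (1 - (t : ℂ) * z)) :=
    continuous_subtype_val.smul (continuous_div_one_sub_mul hz z)
  rw [kernelTransform, integral_weightedMeasure, stieltjesTransform, h1, ← integral_add
    (integrable_const _) (integrable_of_continuous_unitInterval hc)]
  refine integral_congr_ae (Filter.Eventually.of_forall fun t => ?_)
  have h := one_sub_mul_ne_zero hz t
  simp only [Complex.real_smul]
  rw [← mul_div_assoc, one_add_div h, sub_add_cancel]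

theorem stieltjesTransform_analyticOnNhd : AnalyticOnNhd ℂ (stieltjesTransform μ) cutPlane := by
  have := isFiniteMeasure_weightedMeasure μ
  exact (analyticOnNhd_const.add kernelTransform_analyticOnNhd).congr isOpen_cutPlane
    fun z hz => (stieltjesTransform_eq hz).symm

/-- Off the real axis the imaginary part is that of a nontrivial kernel transform, hence nonzero; on
`(-∞, 1)` the integrand is positive. -/
theorem stieltjesTransform_ne_zero (hμ : ∫ t : unitInterval, (t : ℝ) ∂μ ≠ 0) {z : ℂ}
    (hz : z ∈ cutPlane) : stieltjesTransform μ z ≠ 0 := by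
  have hfin := isFiniteMeasure_weightedMeasure μ
  have hw := weightedMeasure_ne_zero hμ
  have him : (stieltjesTransform μ z).im = (kernelTransform (weightedMeasure μ) z).im := by
    simp [stieltjesTransform_eq hz]
  intro h0
  rw [h0, Complex.zero_im] at him
  rcases lt_trichotomy z.im 0 with h | h | h
  · linarith [kernelTransform_im_neg hw h]
  · have hμ0 : μ ≠ 0 := by
      rintro rfl
      simp at hμ
    have hc := continuous_div_one_sub_mul hz 1
    have hre : z.re < 1 := by
      by_contra! h1
      exact hz ⟨z.re, h1, Complex.ext rfl (by simp [h])⟩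
    have hpos : 0 < ∫ t : unitInterval, (1 / (1 - (t : ℂ) * z)).re ∂μ := by
      refine integral_pos_of_continuous_unitInterval hμ0 (Complex.continuous_re.comp hc) fun t => ?_
      rw [one_div, Complex.inv_re]
      refine div_pos ?_ (Complex.normSq_pos.2 (one_sub_mul_ne_zero hz t))
      simpa using one_sub_mul_pos hre t
    rw [← re_integral_unitInterval hc] at hpos
    rw [stieltjesTransform] at h0
    rw [h0] at hpos
    simp at hpos
  · linarith [kernelTransform_im_pos hw h]

/-- `∫ -log (1 - t z) dμ(t)` is a primitive of `∫ t / (1 - t z) dμ(t)`. -/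
theorem hasDerivAt_integral_neg_log {z : ℂ} (hz : z ∈ cutPlane) :
    HasDerivAt (fun w : ℂ => ∫ t : unitInterval, -Complex.log (1 - (t : ℂ) * w) ∂μ)
      (stieltjesTransform (weightedMeasure μ) z) z := by
  rw [stieltjesTransform, integral_weightedMeasure]
  refine hasDerivAt_integral_unitInterval (φ := fun t w => -Complex.log (1 - (t : ℂ) * w))
    (φ' := fun t w => (t : ℝ) • (1 / (1 - (t : ℂ) * w))) isOpen_cutPlane ?_ ?_ ?_ hz
  · intro w hw
    exact (Continuous.clog (by fun_prop) fun t => one_sub_mul_mem_slitPlane hw t).neg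
  · have h1 : ContinuousOn (fun p : unitInterval × ℂ => 1 / (1 - (p.1 : ℂ) * p.2))
        (Set.univ ×ˢ cutPlane) :=
      ContinuousOn.div (by fun_prop) (by fun_prop) fun p hp => one_sub_mul_ne_zero hp.2 p.1
    exact ContinuousOn.smul (f := fun p : unitInterval × ℂ => (p.1 : ℝ)) (by fun_prop) h1
  · intro t w hw
    have h2 : HasDerivAt (fun w : ℂ => 1 - (t : ℂ) * w) (-(t : ℂ)) w := by
      simpa using ((hasDerivAt_id w).const_mul (t : ℂ)).const_sub 1
    refine (h2.clog (one_sub_mul_mem_slitPlane hw t)).neg.congr_deriv ?_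
    simp [div_eq_mul_inv]

theorem hasMappingProperty_of_eqOn_stieltjesTransform (hμ : ∫ t : unitInterval, (t : ℝ) ∂μ ≠ 0)
    {f : ℂ → ℂ} (hf : Set.EqOn f (stieltjesTransform μ) cutPlane) : HasMappingProperty f := by
  have := isFiniteMeasure_weightedMeasure μ
  exact hasMappingProperty_of_kernelTransform (weightedMeasure_ne_zero hμ) (C := μ.real Set.univ)
    fun z hz => (hf hz).trans (stieltjesTransform_eq hz)

theorem hasMappingProperty_of_eqOn_mul_stieltjesTransform (hμ : μ ≠ 0)
    {f : ℂ → ℂ} (hf : Set.EqOn f (fun z => z * stieltjesTransform μ z) cutPlane) :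
    HasMappingProperty f :=
  hasMappingProperty_of_kernelTransform hμ (C := 0) fun z hz => by
    simp [hf hz, mul_stieltjesTransform]

end StieltjesTransform

/-! ### Analytic continuation and the integral representations -/

theorem IsHypergeometricContinuation.eqOn {a b c : ℂ} {f g : ℂ → ℂ}
    (hf : IsHypergeometricContinuation a b c f) (hg : IsHypergeometricContinuation a b c g) :
    Set.EqOn f g cutPlane := by
  refine hf.analytic.eqOn_of_preconnected_of_eventuallyEq hg.analytic isPreconnected_cutPlane
    (z₀ := 0) (ball_subset_cutPlane (Metric.mem_ball_self one_pos)) ?_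
  filter_upwards [Metric.ball_mem_nhds (0 : ℂ) one_pos] with z hz
  rw [hf.eq_series z hz, hg.eq_series z hz]

theorem IsHypergeometricContinuation.gaussF {a b c : ℂ} {f : ℂ → ℂ}
    (hf : IsHypergeometricContinuation a b c f) :
    IsHypergeometricContinuation a b c (gaussF a b c) := by
  have h : ∃ f : ℂ → ℂ, IsHypergeometricContinuation a b c f := ⟨f, hf⟩
  rw [_root_.gaussF, dif_pos h]
  exact h.choose_spec

/-- Compares coefficients of `X`. It evaluates the first moments of the measures, whose nonvanishing
excludes constant transforms. -/
theorem coeff_one_eq_of_mul_eq_add {p q r m : PowerSeries ℝ} {κ : ℝ}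
    (hp : PowerSeries.constantCoeff p = 1) (hr : PowerSeries.constantCoeff r = 1)
    (hm : PowerSeries.constantCoeff m = 1) (hmul : q = p * m)
    (hadd : q = p + PowerSeries.C κ * PowerSeries.X * r) : PowerSeries.coeff 1 m = κ := by
  have h := congrArg (PowerSeries.coeff 1) (hmul.symm.trans hadd)
  rw [PowerSeries.coeff_one_mul, map_add, mul_assoc, PowerSeries.coeff_C_mul,
    ← zero_add 1, PowerSeries.coeff_succ_X_mul, zero_add,
    PowerSeries.coeff_zero_eq_constantCoeff_apply, hp, hr, hm] at h
  linarith

theorem seriesValue_add_C_mul_X_mul {p r : PowerSeries ℝ} {κ : ℝ} {ω : ℂ} (hp : SummableAt p ω)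
    (hr : SummableAt r ω) :
    seriesValue (p + PowerSeries.C κ * PowerSeries.X * r) ω =
      seriesValue p ω + κ * ω * seriesValue r ω := by
  have h1 : Summable fun n => ((PowerSeries.coeff n (PowerSeries.C κ * PowerSeries.X * r) : ℝ) : ℂ)
      * ω ^ n := by
    rw [← summable_nat_add_iff 1]
    refine (hr.of_norm.mul_left (κ * ω)).congr fun n => ?_
    rw [mul_assoc (PowerSeries.C κ), PowerSeries.coeff_C_mul, PowerSeries.coeff_succ_X_mul]
    push_cast
    ring
  have h2 : ∑' n, ((PowerSeries.coeff n (PowerSeries.C κ * PowerSeries.X * r) : ℝ) : ℂ) * ω ^ n =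
      κ * ω * seriesValue r ω := by
    rw [h1.tsum_eq_zero_add, seriesValue, ← tsum_mul_left]
    simp only [mul_assoc, PowerSeries.coeff_C_mul, PowerSeries.coeff_succ_X_mul,
      PowerSeries.coeff_zero_X_mul]
    simp only [mul_zero, Complex.ofReal_zero, zero_mul, zero_add]
    refine tsum_congr fun n => ?_
    push_cast
    ring
  rw [← h2, seriesValue, seriesValue, ← hp.of_norm.tsum_add h1]
  refine tsum_congr fun n => ?_
  rw [map_add]
  push_cast
  ring

theorem seriesValue_zero (p : PowerSeries ℝ) :
    seriesValue p 0 = (PowerSeries.constantCoeff p : ℝ) := by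
  rw [seriesValue, tsum_eq_single 0 fun n hn => by simp [hn]]
  simp

/-- The data behind all six quotients: a nowhere vanishing continuation `E` of `F(a+1, b; c+1)`
and measures representing the other hypergeometric functions relative to `E`. -/
theorem exists_representation {a b c : ℝ} (ha : -1 < a) (hac : a ≤ c) (hb : 0 ≤ b) (hbc : b ≤ c) :
    ∃ (E : ℂ → ℂ) (μ ρ σ : Measure unitInterval), IsProbabilityMeasure μ ∧ IsFiniteMeasure ρ ∧
      IsProbabilityMeasure σ ∧ (∀ ω, E ω ≠ 0) ∧
      IsHypergeometricContinuation (a + 1) b (c + 1) E ∧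
      IsHypergeometricContinuation (a + 1) (b + 1) (c + 1)
        (fun ω => E ω * stieltjesTransform μ ω) ∧
      IsHypergeometricContinuation (a + 2) (b + 1) (c + 2)
        (fun ω => E ω * stieltjesTransform ρ ω) ∧
      IsHypergeometricContinuation (a + 2) (b + 1) (c + 2)
        (fun ω => E ω * stieltjesTransform μ ω * stieltjesTransform σ ω) ∧
      ∫ t : unitInterval, (t : ℝ) ∂μ ≠ 0 ∧ ρ ≠ 0 ∧ ∫ t : unitInterval, (t : ℝ) ∂ρ ≠ 0 ∧
      (a < c → ∫ t : unitInterval, (t : ℝ) ∂σ ≠ 0) := by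
  have hc : 0 ≤ c := hb.trans hbc
  obtain ⟨μ, hμ, hμs⟩ := exists_measure_first_ratio ha hac hb hbc
  obtain ⟨σ, hσ, hσs⟩ := exists_measure_last_ratio ha hac hb hbc
  have hm1 : ∀ ν : Measure unitInterval, IsProbabilityMeasure ν → PowerSeries.constantCoeff
      (PowerSeries.mk fun n => ∫ t : unitInterval, (t : ℝ) ^ n ∂ν) = 1 := by
    intro ν hν
    simp [← PowerSeries.coeff_zero_eq_constantCoeff_apply]
  set κ : ℝ := (a + 1) / (c + 1) with hκ_def
  have hκ : 0 < κ := div_pos (by linarith) (by linarith)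
  have hadd : hypergeometricPowerSeries (a + 1) (b + 1) (c + 1) =
      hypergeometricPowerSeries (a + 1) b (c + 1) + PowerSeries.C κ * PowerSeries.X *
        hypergeometricPowerSeries (a + 2) (b + 1) (c + 2) := by
    have h := hypergeometricPowerSeries_succ_middle (a + 1) b (c := c + 1) (by linarith)
    rwa [add_assoc a, add_assoc c, one_add_one_eq_two] at h
  have hμκ : ∫ t : unitInterval, (t : ℝ) ∂μ = κ := by
    have h := coeff_one_eq_of_mul_eq_add (hypergeometricPowerSeries_constantCoeff _ _ _)
      (hypergeometricPowerSeries_constantCoeff _ _ _) (hm1 μ hμ) hμs hadd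
    simpa using h
  have hσκ : ∫ t : unitInterval, (t : ℝ) ∂σ =
      (b + 1) * (c + 1 - (a + 1)) / ((c + 1) * (c + 1 + 1)) := by
    have h' := hypergeometricPowerSeries_succ_left_right (a + 1) (b + 1) (c := c + 1) (by linarith)
    rw [show a + 1 + 1 = a + 2 by ring, show c + 1 + 1 = c + 2 by ring] at h'
    have h := coeff_one_eq_of_mul_eq_add (hypergeometricPowerSeries_constantCoeff _ _ _)
      (hypergeometricPowerSeries_constantCoeff _ _ _) (hm1 σ hσ) hσs h'
    rw [show c + 1 + 1 = c + 2 by ring]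
    simpa using h
  have hfin := isFiniteMeasure_weightedMeasure μ
  -- By `hadd` the third quotient is `(M(ω) - 1) / (κω)` with `M` the transform of `μ`, which is
  -- `κ⁻¹ ∫ t / (1 - tω) dμ(t)`.
  set ρ : Measure unitInterval := ENNReal.ofReal κ⁻¹ • weightedMeasure μ with hρ_def
  have hρfin : IsFiniteMeasure ρ := Measure.smul_finite _ ENNReal.ofReal_ne_top
  have hρN : ∀ ω, stieltjesTransform ρ ω =
      (κ : ℂ)⁻¹ * stieltjesTransform (weightedMeasure μ) ω := by
    intro ω
    rw [stieltjesTransform, stieltjesTransform, hρ_def, integral_smul_measure,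
      ENNReal.toReal_ofReal (inv_nonneg.2 hκ.le), Complex.real_smul, Complex.ofReal_inv]
  have hρt : ∫ t : unitInterval, (t : ℝ) ∂ρ ≠ 0 := by
    rw [hρ_def, integral_smul_measure, ENNReal.toReal_ofReal (inv_nonneg.2 hκ.le),
      integral_weightedMeasure]
    exact (mul_pos (inv_pos.2 hκ) (integral_sq_pos (hμκ ▸ hκ))).ne'
  have hρ0 : ρ ≠ 0 := by
    intro h
    rw [h] at hρt
    simp at hρt
  have hs0 : ∀ {ω : ℂ}, ‖ω‖ < 1 → SummableAt (hypergeometricPowerSeries (a + 1) b (c + 1)) ω :=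
    fun h => summableAt_hypergeometricPowerSeries (by linarith) hb (by linarith) h
  have hs1 : ∀ {ω : ℂ}, ‖ω‖ < 1 →
      SummableAt (hypergeometricPowerSeries (a + 1) (b + 1) (c + 1)) ω :=
    fun h => summableAt_hypergeometricPowerSeries (by linarith) (by linarith) (by linarith) h
  have hs2 : ∀ {ω : ℂ}, ‖ω‖ < 1 →
      SummableAt (hypergeometricPowerSeries (a + 2) (b + 1) (c + 2)) ω :=
    fun h => summableAt_hypergeometricPowerSeries (by linarith) (by linarith) (by linarith) h
  have hF1 : ∀ {ω : ℂ}, ‖ω‖ < 1 →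
      seriesValue (hypergeometricPowerSeries (a + 1) (b + 1) (c + 1)) ω =
      seriesValue (hypergeometricPowerSeries (a + 1) b (c + 1)) ω * stieltjesTransform μ ω := by
    intro ω hω
    rw [hμs, seriesValue_mul (hs0 hω) (summableAt_moments μ hω), seriesValue_moments μ hω]
    rfl
  have hF2 : ∀ {ω : ℂ}, ‖ω‖ < 1 →
      seriesValue (hypergeometricPowerSeries (a + 2) (b + 1) (c + 2)) ω =
      seriesValue (hypergeometricPowerSeries (a + 1) (b + 1) (c + 1)) ω *
        stieltjesTransform σ ω := by
    intro ω hω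
    rw [hσs, seriesValue_mul (hs1 hω) (summableAt_moments σ hω), seriesValue_moments σ hω]
    rfl
  have hF2' : ∀ {ω : ℂ}, ‖ω‖ < 1 →
      κ * seriesValue (hypergeometricPowerSeries (a + 2) (b + 1) (c + 2)) ω =
      seriesValue (hypergeometricPowerSeries (a + 1) b (c + 1)) ω *
        stieltjesTransform (weightedMeasure μ) ω := by
    intro ω hω
    rcases eq_or_ne ω 0 with rfl | hω0
    · rw [seriesValue_zero, seriesValue_zero, hypergeometricPowerSeries_constantCoeff,
        hypergeometricPowerSeries_constantCoeff, stieltjesTransform, integral_weightedMeasure,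
        ← hμκ, ← integral_complex_ofReal]
      simp
    · have h := hF1 hω
      rw [hadd, seriesValue_add_C_mul_X_mul (hs0 hω) (hs2 hω), stieltjesTransform_eq
        (ball_subset_cutPlane (by simpa using hω)), ← mul_stieltjesTransform] at h
      simp only [probReal_univ, Complex.ofReal_one] at h
      refine mul_left_cancel₀ hω0 ?_
      linear_combination h
  -- `F(a+1,b;c+1)' = bκ F(a+2,b+1;c+2)`, so by `hF2'` the logarithmic derivative should be `b ∫ t /
  -- (1 - tω) dμ(t)`. `P` is its primitive vanishing at `0`, defined on the whole slit plane.
  -- Differentiating `F · exp(-P)` below avoids dividing by `F`.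
  let P : ℂ → ℂ := fun ω => b * ∫ t : unitInterval, -Complex.log (1 - (t : ℂ) * ω) ∂μ
  have hP : ∀ ω ∈ cutPlane, HasDerivAt P (b * stieltjesTransform (weightedMeasure μ) ω) ω :=
    fun ω hω => (hasDerivAt_integral_neg_log hω).const_mul _
  have hE : AnalyticOnNhd ℂ (fun ω => Complex.exp (P ω)) cutPlane :=
    DifferentiableOn.analyticOnNhd (fun ω hω =>
      (hP ω hω).cexp.differentiableAt.differentiableWithinAt) isOpen_cutPlane
  have hE0 : ∀ {ω : ℂ}, ‖ω‖ < 1 →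
      seriesValue (hypergeometricPowerSeries (a + 1) b (c + 1)) ω = Complex.exp (P ω) := by
    have hd : ∀ ω ∈ Metric.ball (0 : ℂ) 1, HasDerivAt (fun ω =>
        seriesValue (hypergeometricPowerSeries (a + 1) b (c + 1)) ω * Complex.exp (-P ω)) 0 ω := by
      intro ω hω
      have hω' : ‖ω‖ < 1 := by simpa using hω
      have h1 := hasDerivAt_seriesValue_hypergeometric (a := a + 1) (b := b) (c := c + 1)
        (by linarith) hb (by linarith) hω'
      rw [show a + 1 + 1 = a + 2 by ring, show c + 1 + 1 = c + 2 by ring,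
        show (a + 1) * b / (c + 1) = b * κ by rw [hκ_def]; ring, Complex.ofReal_mul, mul_assoc,
        hF2' hω'] at h1
      refine (h1.mul (hP ω (ball_subset_cutPlane hω)).neg.cexp).congr_deriv ?_
      ring
    intro ω hω
    have hω' : ω ∈ Metric.ball (0 : ℂ) 1 := by simpa using hω
    have hconst := Metric.isOpen_ball.is_const_of_deriv_eq_zero (𝕜 := ℂ)
      (convex_ball (0 : ℂ) 1).isPreconnected
      (fun z hz => (hd z hz).differentiableAt.differentiableWithinAt)
      (fun z hz => (hd z hz).deriv) hω' (Metric.mem_ball_self one_pos)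
    have hP0 : P 0 = 0 := by simp [P]
    simp only [hP0, seriesValue_zero, hypergeometricPowerSeries_constantCoeff, neg_zero,
      Complex.exp_zero, Complex.ofReal_one, mul_one] at hconst
    rw [Complex.exp_neg, mul_inv_eq_iff_eq_mul₀ (Complex.exp_ne_zero _), one_mul] at hconst
    exact hconst
  have hcont : ∀ (α β γ : ℝ) (f : ℂ → ℂ), AnalyticOnNhd ℂ f cutPlane →
      (∀ ω : ℂ, ‖ω‖ < 1 → f ω = seriesValue (hypergeometricPowerSeries α β γ) ω) →
      IsHypergeometricContinuation α β γ f := by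
    intro α β γ f h1 h2
    refine ⟨h1, fun ω hω => ?_⟩
    rw [ordinaryHypergeometric_eq_seriesValue, h2 ω (by simpa using hω)]
  have hEμ := hE.mul (stieltjesTransform_analyticOnNhd (μ := μ))
  refine ⟨fun ω => Complex.exp (P ω), μ, ρ, σ, hμ, hρfin, hσ, fun ω => Complex.exp_ne_zero _,
    ?_, ?_, ?_, ?_, hμκ ▸ hκ.ne', hρ0, hρt, fun h => ?_⟩
  · exact_mod_cast hcont (a + 1) b (c + 1) _ hE fun ω hω => (hE0 hω).symm
  · exact_mod_cast hcont (a + 1) (b + 1) (c + 1) _ hEμ fun ω hω => by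
      rw [hF1 hω, hE0 hω]
  · exact_mod_cast hcont (a + 2) (b + 1) (c + 2) _
      (hE.mul (stieltjesTransform_analyticOnNhd (μ := ρ))) fun ω hω => by
      have hκ' : (κ : ℂ) ≠ 0 := by exact_mod_cast hκ.ne'
      refine mul_left_cancel₀ hκ' ?_
      rw [hF2' hω, hE0 hω, hρN]
      field_simp
  · exact_mod_cast hcont (a + 2) (b + 1) (c + 2) _
      (hEμ.mul (stieltjesTransform_analyticOnNhd (μ := σ))) fun ω hω => by
      rw [hF2 hω, hF1 hω, hE0 hω]
  · rw [hσκ]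
    exact (div_pos (mul_pos (by linarith) (by linarith)) (by positivity)).ne'

theorem mainTheorem3 (a b c : ℝ) (ha : -1 < a) (hac : a ≤ c) (hb : 0 ≤ b) (hbc : b ≤ c) :
    -- the hypergeometric functions involved continue analytically to `ℂ ∖ [1, ∞)`
    (IsHypergeometricContinuation (a + 1) b (c + 1) (gaussF (a + 1) b (c + 1)) ∧
      IsHypergeometricContinuation (a + 1) (b + 1) (c + 1) (gaussF (a + 1) (b + 1) (c + 1)) ∧
      IsHypergeometricContinuation (a + 2) (b + 1) (c + 2) (gaussF (a + 2) (b + 1) (c + 2))) ∧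
    -- the denominators have no zeros there
    (∀ ω ∈ cutPlane, gaussF (a + 1) b (c + 1) ω ≠ 0 ∧ gaussF (a + 1) (b + 1) (c + 1) ω ≠ 0) ∧
    -- the six ratios are analytic there
    (AnalyticOnNhd ℂ
        (fun ω => gaussF (a + 1) (b + 1) (c + 1) ω / gaussF (a + 1) b (c + 1) ω) cutPlane ∧
      AnalyticOnNhd ℂ
        (fun ω => ω * gaussF (a + 1) (b + 1) (c + 1) ω / gaussF (a + 1) b (c + 1) ω) cutPlane ∧
      AnalyticOnNhd ℂ
        (fun ω => gaussF (a + 2) (b + 1) (c + 2) ω / gaussF (a + 1) b (c + 1) ω) cutPlane ∧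
      AnalyticOnNhd ℂ
        (fun ω => ω * gaussF (a + 2) (b + 1) (c + 2) ω / gaussF (a + 1) b (c + 1) ω) cutPlane ∧
      AnalyticOnNhd ℂ
        (fun ω => gaussF (a + 2) (b + 1) (c + 2) ω / gaussF (a + 1) (b + 1) (c + 1) ω)
        cutPlane ∧
      AnalyticOnNhd ℂ
        (fun ω => ω * gaussF (a + 2) (b + 1) (c + 2) ω / gaussF (a + 1) (b + 1) (c + 1) ω)
        cutPlane) ∧
    -- the mapping properties; the fifth ratio is the constant 1 if `a = c`
    HasMappingProperty
      (fun ω => gaussF (a + 1) (b + 1) (c + 1) ω / gaussF (a + 1) b (c + 1) ω) ∧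
    HasMappingProperty
      (fun ω => ω * gaussF (a + 1) (b + 1) (c + 1) ω / gaussF (a + 1) b (c + 1) ω) ∧
    HasMappingProperty
      (fun ω => gaussF (a + 2) (b + 1) (c + 2) ω / gaussF (a + 1) b (c + 1) ω) ∧
    HasMappingProperty
      (fun ω => ω * gaussF (a + 2) (b + 1) (c + 2) ω / gaussF (a + 1) b (c + 1) ω) ∧
    (a < c → HasMappingProperty
      (fun ω => gaussF (a + 2) (b + 1) (c + 2) ω / gaussF (a + 1) (b + 1) (c + 1) ω)) ∧
    HasMappingProperty
      (fun ω => ω * gaussF (a + 2) (b + 1) (c + 2) ω / gaussF (a + 1) (b + 1) (c + 1) ω) := by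
  obtain ⟨E, μ, ρ, σ, hμ, hρ, hσ, hE, h0, h1, h2, h2', hμt, hρ0, hρt, hσt⟩ :=
    exists_representation ha hac hb hbc
  have e0 := h0.gaussF.eqOn h0
  have e1 := h1.gaussF.eqOn h1
  have e2 := h2.gaussF.eqOn h2
  have e2' := h2'.gaussF.eqOn h2'
  have hM : ∀ ω ∈ cutPlane, stieltjesTransform μ ω ≠ 0 :=
    fun ω hω => stieltjesTransform_ne_zero hμt hω
  have n0 : ∀ ω ∈ cutPlane, gaussF (a + 1) b (c + 1) ω ≠ 0 := fun ω hω => by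
    rw [e0 hω]
    exact hE ω
  have n1 : ∀ ω ∈ cutPlane, gaussF (a + 1) (b + 1) (c + 1) ω ≠ 0 := fun ω hω => by
    rw [e1 hω]
    exact mul_ne_zero (hE ω) (hM ω hω)
  have r1 : ∀ ω ∈ cutPlane, gaussF (a + 1) (b + 1) (c + 1) ω / gaussF (a + 1) b (c + 1) ω =
      stieltjesTransform μ ω := fun ω hω => by
    rw [e0 hω, e1 hω, mul_div_cancel_left₀ _ (hE ω)]
  have r3 : ∀ ω ∈ cutPlane, gaussF (a + 2) (b + 1) (c + 2) ω / gaussF (a + 1) b (c + 1) ω =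
      stieltjesTransform ρ ω := fun ω hω => by
    rw [e0 hω, e2 hω, mul_div_cancel_left₀ _ (hE ω)]
  have r5 : ∀ ω ∈ cutPlane, gaussF (a + 2) (b + 1) (c + 2) ω / gaussF (a + 1) (b + 1) (c + 1) ω =
      stieltjesTransform σ ω := fun ω hω => by
    rw [e1 hω, e2' hω, mul_div_cancel_left₀ _ (mul_ne_zero (hE ω) (hM ω hω))]
  have a0 := h0.gaussF.analytic
  have a1 := h1.gaussF.analytic
  have a2 := h2.gaussF.analytic
  have hid : AnalyticOnNhd ℂ (fun ω : ℂ => ω) cutPlane := analyticOnNhd_id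
  refine ⟨⟨h0.gaussF, h1.gaussF, h2.gaussF⟩, fun ω hω => ⟨n0 ω hω, n1 ω hω⟩,
    ⟨a1.div a0 n0, (hid.mul a1).div a0 n0, a2.div a0 n0, (hid.mul a2).div a0 n0, a2.div a1 n1,
      (hid.mul a2).div a1 n1⟩,
    hasMappingProperty_of_eqOn_stieltjesTransform hμt r1,
    hasMappingProperty_of_eqOn_mul_stieltjesTransform (IsProbabilityMeasure.ne_zero μ)
      fun ω hω => ?_,
    hasMappingProperty_of_eqOn_stieltjesTransform hρt r3,
    hasMappingProperty_of_eqOn_mul_stieltjesTransform hρ0 fun ω hω => ?_,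
    fun h => hasMappingProperty_of_eqOn_stieltjesTransform (hσt h) r5,
    -- With the factor `ω` only `σ ≠ 0` matters, so `a = c` is allowed: then `σ` is the point mass
    -- at `0` and the function is `ω`.
    hasMappingProperty_of_eqOn_mul_stieltjesTransform (IsProbabilityMeasure.ne_zero σ)
      fun ω hω => ?_⟩
  · simp only [mul_div_assoc, r1 ω hω]
  · simp only [mul_div_assoc, r3 ω hω]
  · simp only [mul_div_assoc, r5 ω hω]
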